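/- **Corollary (Accordance with Self-Adjoint Extensions).** Let $\hbar,m>0$, $\alpha\in\mathbb R\setminus\{0\}$, $L\in\mathbb R\setminus\{0\}$, let $\gamma$ be the Euler–Mascheroni constant, and consider on $\mathbb R^2$ the formal symbol $H=-\frac{\hbar^2}{2m}\Delta-\alpha\,\delta(x)$, where $\Delta$ is the distributional Laplacian. For a function $\psi$ with $\psi(x)=c\log(|x|/|L|)+d+o(1)$ as $x\to0$ $(c,d\in\mathbb C)$ the product $\psi\delta$ at length scale $L$ is the distribution $d\,\delta$ (so that $\log(|x|/|L|)\,\delta=0$), and then $H\psi:=-\frac{\hbar^2}{2m}\Delta\psi-\alpha\,\psi\delta\in\mathcal D'(\mathbb R^2)$. A stationary state of energy $E\in\mathbb C$ at scale $L$ is a nonzero $\psi\in L^2(\mathbb R^2)$ for which $\psi\delta$ is so defined and $\langle H\psi,\varphi\rangle=E\langle\psi,\varphi\rangle$ for all test functions $\varphi\in C_c^\infty(\mathbb R^2)$. The C-spectrum is the family, indexed by $L\in\mathbb R\setminus\{0\}$, of the sets $\sigma_C(\hbar,m,\alpha,L)$ of energies of stationary states at scale $L$. Suppose $\hbar^2/m=2$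 and $L=\pm1$. 1. For every $\alpha\in\mathbb R\setminus\{0\}$, $$\sigma_C(\hbar,m,\alpha,L)=\left\{-4e^{-2\gamma-4\pi/\alpha}\right\},$$ and for $E$ in this set the function $\psi(x)=\frac{b}{\sqrt\pi}K_0(b|x|)$ with $b=\sqrt{2m|E|}/\hbar$, where $K_0(z)=\int_0^\infty e^{-z\cosh t}\,dt$ is the MacDonald function of order zero, is a stationary state of energy $E$ at scale $L$. 2. For $a\in\mathbb R$ let $-\Delta_{a,0}$ be the point-interaction Hamiltonian in $L^2(\mathbb R^2)$ of Albeverio, Gesztesy, Høegh-Krohn and Holden: the extension of $-\Delta|_{C_c^\infty(\mathbb R^2\setminus\{0\})}$ obtained by restricting its adjoint to those $\psi$ that (after a change on a null set) satisfy $\psi(x)=-\frac{q}{2\pi}\log|x|+a\,q+o(1)$ as $x\to0$ for some $q\in\mathbb C$. Then for every $a\in\mathbb R\setminus\{0\}$ its point spectrum is the above singleton with $\alpha$ replaced by $1/a$: $$\sigma_p(-\Delta_{a,0})=\sigma_C(\hbar,m,1/a,L).$$ -/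

import Mathlib

open scoped Distributions LineDeriv

noncomputable section

namespace PointInteraction

open MeasureTheory Filter Topology TopologicalSpace

/-- The Euclidean plane `ℝ²`. -/
abbrev Plane : Type := EuclideanSpace ℝ (Fin 2)

/-- The Hilbert space `L²(ℝ²; ℂ)`. -/
abbrev L2 : Type := Lp ℂ 2 (volume : Measure Plane)

/-- The `i`-th standard basis vector of the plane. -/
def stdVec (i : Fin 2) : Plane := EuclideanSpace.single i 1

/-! ### Distributions on the plane and the symbol `H ψ` -/

/-- Complex-valued distributions on `ℝ²`. -/
abbrev Distr : Type := 𝓓'((⊤ : Opens Plane), ℂ)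

/-- The regular distribution `φ ↦ ∫ φ ψ` of a function `ψ` (meaningful for locally integrable `ψ`;
below it is only used for square integrable `ψ`). -/
def regularDistr (ψ : Plane → ℂ) : Distr :=
  (TestFunction.integralAgainstBilinCLM (ContinuousLinearMap.lsmul ℝ ℝ) volume ψ :
    𝓓((⊤ : Opens Plane), ℝ) →L[ℝ] ℂ)

/-- The Dirac distribution at the origin. -/
def deltaZero : Distr := Distribution.mapCLM Complex.ofRealCLM (Distribution.delta 0)

/-- The distributional Laplace operator `Δ = ∂₁² + ∂₂²`. -/
def distrLaplacian (T : Distr) : Distr :=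
  ∂_{stdVec 0} (∂_{stdVec 0} T) + ∂_{stdVec 1} (∂_{stdVec 1} T)

/-- `IsDeltaProduct L ψ T`: the product `ψ(x) δ(x)` is the distribution `T`, at the length scale
`L`. Products are computed by the rule that `log (|x| / |L|) δ(x)` is the zero distribution and that
`f(x) δ(x) = f(0) δ(x)` for `f` continuous at the origin: if
`ψ(x) = c log (|x| / |L|) + d + o(1)` as `x → 0`, then `ψ δ = d δ`. -/
def IsDeltaProduct (L : ℝ) (ψ : Plane → ℂ) (T : Distr) : Prop :=
  ∃ c d : ℂ,
    Tendsto (fun x : Plane => ψ x - c * (Real.log (‖x‖ / |L|) : ℂ)) (𝓝[≠] 0) (𝓝 d) ∧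
    T = d • deltaZero

/-- `IsHamiltonianApply ħ m α L ψ S`: the formal expression `H ψ = -(ħ²/2m) Δψ - α δ ψ` is, at the
length scale `L`, the distribution `S`. -/
def IsHamiltonianApply (ħ m α L : ℝ) (ψ : Plane → ℂ) (S : Distr) : Prop :=
  ∃ T : Distr, IsDeltaProduct L ψ T ∧
    S = -((ħ ^ 2 / (2 * m)) • distrLaplacian (regularDistr ψ)) - α • T

/-- `ψ` is a stationary (bound) state of energy `E` at the length scale `L`: it is a nonzero element
of `L²(ℝ²)`, `H ψ` is a distribution, and `⟨H ψ, φ⟩ = E ⟨ψ, φ⟩` for all test functions `φ`. -/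
def IsStationaryState (ħ m α L : ℝ) (E : ℂ) (ψ : Plane → ℂ) : Prop :=
  MemLp ψ 2 volume ∧ ¬ (ψ =ᵐ[volume] 0) ∧
    ∃ S : Distr, IsHamiltonianApply ħ m α L ψ S ∧ S = E • regularDistr ψ

/-- The member of index `L` of the C-spectral family: the energies of the stationary states at the
length scale `L`. -/
def cSpectrum (ħ m α L : ℝ) : Set ℂ :=
  {E : ℂ | ∃ ψ : Plane → ℂ, IsStationaryState ħ m α L E ψ}

/-- The MacDonald function of order zero, `K₀(z) = ∫_0^∞ exp(-z cosh t) dt` for `z > 0`. -/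
def macdonaldK0 (z : ℝ) : ℝ := ∫ t in Set.Ioi (0 : ℝ), Real.exp (-z * Real.cosh t)

/-- The wave function `ψ(x) = (b / √π) K₀(b|x|)` with `b² = 2 m |E| / ħ²`. -/
def boundWave (ħ m E : ℝ) (x : Plane) : ℂ :=
  let b : ℝ := Real.sqrt (2 * m * |E| / ħ ^ 2)
  ((b / Real.sqrt Real.pi * macdonaldK0 (b * ‖x‖) : ℝ) : ℂ)

/-! ### The point-interaction Hamiltonian as an operator in `L²(ℝ²)` -/

/-- The punctured plane `ℝ² ∖ {0}`. -/
def punctured : Opens Plane := ⟨{0}ᶜ, isOpen_compl_singleton⟩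

/-- `C_c^∞(ℝ² ∖ {0})`. -/
abbrev PuncturedTest : Type := 𝓓(punctured, ℂ)

lemma memLp_test (f : PuncturedTest) : MemLp f 2 (volume : Measure Plane) :=
  f.continuous.memLp_of_hasCompactSupport f.hasCompactSupport

/-- The inclusion `C_c^∞(ℝ² ∖ {0}) → L²(ℝ²)`. -/
def testToL2 : PuncturedTest →ₗ[ℂ] L2 where
  toFun f := (memLp_test f).toLp f
  map_add' _ _ := rfl
  map_smul' _ _ := rfl

lemma testToL2_injective : Function.Injective testToL2 := by
  intro f g h
  have h0 : (memLp_test f).toLp f = (memLp_test g).toLp g := h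
  have h1 : (f : Plane → ℂ) =ᵐ[volume] g := (MemLp.toLp_eq_toLp_iff _ _).1 h0
  have h2 : (f : Plane → ℂ) = g := (Continuous.ae_eq_iff_eq _ f.continuous g.continuous).1 h1
  exact DFunLike.coe_injective h2

/-- The negative Laplacian `-(∂₁² + ∂₂²)` on `C_c^∞(ℝ² ∖ {0})`. -/
def negLaplacianTest : PuncturedTest →ₗ[ℂ] PuncturedTest :=
  -(((TestFunction.lineDerivCLM ℂ (stdVec 0) : PuncturedTest →L[ℂ] PuncturedTest).comp
      (TestFunction.lineDerivCLM ℂ (stdVec 0))) +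
    ((TestFunction.lineDerivCLM ℂ (stdVec 1) : PuncturedTest →L[ℂ] PuncturedTest).comp
      (TestFunction.lineDerivCLM ℂ (stdVec 1)))).toLinearMap

/-- The symmetric operator `-Δ` in `L²(ℝ²)` with domain `C_c^∞(ℝ² ∖ {0})`. -/
def minimalOperator : L2 →ₗ.[ℂ] L2 where
  domain := LinearMap.range testToL2
  toFun := (testToL2 ∘ₗ negLaplacianTest) ∘ₗ
    (LinearEquiv.ofInjective testToL2 testToL2_injective).symm.toLinearMap

lemma minimalOperator_apply (f : PuncturedTest) :
    minimalOperator ⟨testToL2 f, LinearMap.mem_range_self _ f⟩ = testToL2 (negLaplacianTest f) := by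
  have h : (LinearEquiv.ofInjective testToL2 testToL2_injective).symm
      ⟨testToL2 f, LinearMap.mem_range_self _ f⟩ = f := by
    rw [LinearEquiv.symm_apply_eq]
    rfl
  exact congrArg (fun g => testToL2 (negLaplacianTest g)) h

/-- The boundary condition of strength `a` at the origin: `ψ` has a representative with
`ψ(x) = -(q / 2π) log|x| + a q + o(1)` as `x → 0`, for some `q ∈ ℂ`. In terms of the boundary values
`ψ₀ = lim ψ(x) / log|x|` and `ψ₁ = lim (ψ(x) - ψ₀ log|x|)` it says `2π a ψ₀ + ψ₁ = 0`. -/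
def boundaryCondition (a : ℝ) : Submodule ℂ L2 where
  carrier := {ψ | ∃ (q : ℂ) (f : Plane → ℂ), (ψ : Plane → ℂ) =ᵐ[volume] f ∧
    Tendsto (fun x : Plane => f x + q / (2 * Real.pi) * (Real.log ‖x‖ : ℂ)) (𝓝[≠] 0)
      (𝓝 (a * q))}
  zero_mem' := ⟨0, 0, Lp.coeFn_zero _ _ _, by simp⟩
  add_mem' := by
    rintro ψ₁ ψ₂ ⟨q₁, f₁, h₁, t₁⟩ ⟨q₂, f₂, h₂, t₂⟩
    refine ⟨q₁ + q₂, f₁ + f₂, (Lp.coeFn_add _ _).trans (h₁.add h₂), ?_⟩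
    rw [mul_add]
    refine (t₁.add t₂).congr fun x => ?_
    simp only [Pi.add_apply]
    ring
  smul_mem' := by
    rintro c ψ ⟨q, f, h, t⟩
    refine ⟨c * q, c • f, (Lp.coeFn_smul _ _).trans (h.const_smul c), ?_⟩
    have t' := t.const_mul c
    rw [show c * ((a : ℂ) * q) = a * (c * q) by ring] at t'
    refine t'.congr fun x => ?_
    simp only [Pi.smul_apply, smul_eq_mul]
    ring

/-- The point-interaction Hamiltonian `-Δ_{a,0}` in `L²(ℝ²)`: the extension of `-Δ` on
`C_c^∞(ℝ² ∖ {0})` obtained by restricting the adjoint to the boundary condition of strength `a`. -/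
def pointHamiltonian (a : ℝ) : L2 →ₗ.[ℂ] L2 :=
  minimalOperator.adjoint.domRestrict (boundaryCondition a)

/-- The point spectrum (set of eigenvalues) of an operator in `L²(ℝ²)`. -/
def pointSpectrum (A : L2 →ₗ.[ℂ] L2) : Set ℂ :=
  {E : ℂ | ∃ ψ : A.domain, ψ ≠ 0 ∧ A ψ = E • (ψ : L2)}

end PointInteraction

end

noncomputable section

namespace PointInteraction

open MeasureTheory Filter Topology TopologicalSpace
open scoped Laplacian ContDiff FourierTransform ComplexConjugate

/-! ### The Laplacian of functions on the plane -/

/-! For `ħ ^ 2 / m = 2` and `|L| = 1`, a stationary state is a nonzero square integrable `ψ = c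
log|x| + d + o(1)` with `-Δψ - Eψ = αd δ`, that is, `(4π²|ξ|² - E) ψ̌(ξ) = αd` for the inverse
Fourier transform `ψ̌`. If `αd = 0`, then `ψ̌` lives on a null set and `ψ = 0`. So the source can be
scaled to `δ`, which makes the regularized value at the origin `1/α`.

The energy is then pinned down in three steps. It is real: `ψ - conj ψ` is the Fourier transform of
`2i (Im E) |ψ̌|²`, an integrable function, hence it is continuous, with value `2i (Im E) ‖ψ̌‖²` at
the origin; that value must be `1/α - 1/α = 0` (`IsWeakSolution.im_eq_zero`). It is negative: for `E
≥ 0` the function `1/(4π²|ξ|² - E)` is not square integrable (`IsWeakSolution.not_nonneg`). Finally,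
with `E = -b²`, uniqueness forces `ψ = K₀(b|x|)/2π`, and the expansion `K₀(z) = -log(z/2) - γ +
o(1)` turns the value `1/α` into `log b = log 2 - γ - 2π/α` (`energy_eq_boundEnergy`). The heat
kernel shows that `K₀(b|x|)/2π` is the Green function (`integral_greenFn_mul`), so this energy does
occur.

An eigenfunction of the point interaction solves `-Δψ = Eψ` only away from the origin. Its boundary
condition fixes the logarithmic coefficient `-q/2π` and the constant `aq`. Subtracting `q` times a
Green function leaves a removable singularity, so `-Δψ - Eψ = qδ` on the whole plane
(`isWeakSolution_of_punctured`). With `d = aq` the source is `(1/a) d δ`: the same problem with `α =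
1/a`. -/

lemma laplacian_eq_sum_fderiv {F : Type*} [NormedAddCommGroup F] [NormedSpace ℝ F] {f : Plane → F}
    (hf : ContDiff ℝ 2 f) (x : Plane) :
    Δ f x = ∑ i, fderiv ℝ (fun y => fderiv ℝ f y (stdVec i)) x (stdVec i) := by
  rw [InnerProductSpace.laplacian_eq_iteratedFDeriv_orthonormalBasis f
    (EuclideanSpace.basisFun (Fin 2) ℝ)]
  refine Finset.sum_congr rfl fun i _ => ?_
  rw [iteratedFDeriv_two_apply]
  have h : DifferentiableAt ℝ (fderiv ℝ f) x :=
    ((hf.fderiv_right (m := 1) (by norm_num)).differentiable (by norm_num)).differentiableAt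
  rw [fderiv_clm_apply h (by fun_prop)]
  simp [stdVec]

lemma two_le_smooth : (2 : WithTop ℕ∞) ≤ ∞ :=
  WithTop.coe_le_coe.2 le_top

lemma contDiff_fderiv_apply {F : Type*} [NormedAddCommGroup F] [NormedSpace ℝ F] {f : Plane → F}
    (hf : ContDiff ℝ ∞ f) (v : Plane) : ContDiff ℝ ∞ (fun x => fderiv ℝ f x v) :=
  (hf.fderiv_right (m := ∞) (by norm_num)).clm_apply contDiff_const

lemma contDiff_laplacian {F : Type*} [NormedAddCommGroup F] [NormedSpace ℝ F] {f : Plane → F}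
    (hf : ContDiff ℝ ∞ f) : ContDiff ℝ ∞ (Δ f) := by
  have : Δ f = fun x => ∑ i, fderiv ℝ (fun y => fderiv ℝ f y (stdVec i)) x (stdVec i) :=
    funext (laplacian_eq_sum_fderiv (hf.of_le two_le_smooth))
  rw [this]
  exact ContDiff.sum fun i _ => contDiff_fderiv_apply (contDiff_fderiv_apply hf _) _

lemma tsupport_laplacian_subset {F : Type*} [NormedAddCommGroup F] [NormedSpace ℝ F]
    (f : Plane → F) : tsupport (Δ f) ⊆ tsupport f := by
  refine closure_minimal (fun x hx => ?_) (isClosed_tsupport f)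
  by_contra h
  apply hx
  have h0 : f =ᶠ[𝓝 x] fun _ => (0 : F) := notMem_tsupport_iff_eventuallyEq.1 h
  have := (InnerProductSpace.laplacian_congr_nhds h0).self_of_nhds
  rw [this]
  simp

lemma HasCompactSupport.laplacian {F : Type*} [NormedAddCommGroup F] [NormedSpace ℝ F]
    {f : Plane → F} (hf : HasCompactSupport f) : HasCompactSupport (Δ f) :=
  hf.of_isClosed_subset (isClosed_tsupport _) (tsupport_laplacian_subset f)

/-- The product rule for the Laplacian, on rescaled cutoffs. -/
lemma laplacian_smul_scaled {χ : Plane → ℝ} {φ : Plane → ℂ} (hχ : ContDiff ℝ ∞ χ)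
    (hφ : ContDiff ℝ ∞ φ) (c : ℝ) (x : Plane) :
    Δ (fun y => χ (c • y) • φ y) x = (c ^ 2 * Δ χ (c • x)) • φ x +
      ∑ i, (2 * c * fderiv ℝ χ (c • x) (stdVec i)) • fderiv ℝ φ x (stdVec i) +
      χ (c • x) • Δ φ x := by
  have hχc : ContDiff ℝ ∞ (fun y => χ (c • y)) := hχ.comp (contDiff_const_smul c)
  have hne : (∞ : WithTop ℕ∞) ≠ 0 := by simp
  have hd : ∀ y v, fderiv ℝ (fun y => χ (c • y)) y v = c * fderiv ℝ χ (c • y) v := by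
    intro y v
    rw [fderiv_comp_smul]; simp
  have h1 : ∀ y v, fderiv ℝ (fun y => χ (c • y) • φ y) y v =
      χ (c • y) • fderiv ℝ φ y v + (c * fderiv ℝ χ (c • y) v) • φ y := by
    intro y v
    rw [fderiv_fun_smul (hχc.differentiable hne y) (hφ.differentiable hne y)]
    simp [hd]
  have h2 : ∀ v, fderiv ℝ (fun y => fderiv ℝ (fun y => χ (c • y) • φ y) y v) x v =
      (c ^ 2 * fderiv ℝ (fun y => fderiv ℝ χ y v) (c • x) v) • φ x +
      (2 * c * fderiv ℝ χ (c • x) v) • fderiv ℝ φ x v +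
      χ (c • x) • fderiv ℝ (fun y => fderiv ℝ φ y v) x v := by
    intro v
    have e1 : (fun y => fderiv ℝ (fun y => χ (c • y) • φ y) y v) =
        fun y => χ (c • y) • fderiv ℝ φ y v + (c * fderiv ℝ χ (c • y) v) • φ y :=
      funext fun y => h1 y v
    have hφv := contDiff_fderiv_apply hφ v
    have hχv := contDiff_fderiv_apply hχ v
    have hχv' : ContDiff ℝ ∞ (fun y => c * fderiv ℝ χ (c • y) v) :=
      contDiff_const.mul (hχv.comp (contDiff_const_smul c))
    have s1 : ContDiff ℝ ∞ (fun y => χ (c • y) • fderiv ℝ φ y v) := hχc.smul hφv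
    have s2 : ContDiff ℝ ∞ (fun y => (c * fderiv ℝ χ (c • y) v) • φ y) := hχv'.smul hφ
    rw [e1, fderiv_fun_add (s1.differentiable hne x) (s2.differentiable hne x),
      fderiv_fun_smul (hχc.differentiable hne x) (hφv.differentiable hne x),
      fderiv_fun_smul (hχv'.differentiable hne x) (hφ.differentiable hne x)]
    have e2 : fderiv ℝ (fun y => c * fderiv ℝ χ (c • y) v) x v =
        c ^ 2 * fderiv ℝ (fun y => fderiv ℝ χ y v) (c • x) v := by
      have s3 : ContDiff ℝ ∞ (fun y => fderiv ℝ χ (c • y) v) := hχv.comp (contDiff_const_smul c)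
      rw [fderiv_const_mul (s3.differentiable hne x)]
      have := fderiv_comp_smul (𝕜 := ℝ) (f := fun y => fderiv ℝ χ y v) (x := x) c
      rw [this]
      simp; ring
    simp only [_root_.add_apply, _root_.smul_apply,
      ContinuousLinearMap.smulRight_apply, e2, hd]
    simp only [Complex.real_smul]
    push_cast
    ring
  have hs : ContDiff ℝ ∞ (fun y => χ (c • y) • φ y) := hχc.smul hφ
  rw [laplacian_eq_sum_fderiv (hs.of_le two_le_smooth), laplacian_eq_sum_fderiv (hχ.of_le two_le_smooth),
    laplacian_eq_sum_fderiv (hφ.of_le two_le_smooth)]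
  simp only [h2, Finset.sum_add_distrib, Finset.mul_sum, Finset.sum_smul, Finset.smul_sum]

/-- A smooth cutoff function equal to one on the unit ball, with bounded derivatives. -/
lemma exists_cutoff : ∃ (χ : Plane → ℝ) (C : ℝ), ContDiff ℝ ∞ χ ∧ HasCompactSupport χ ∧ 0 ≤ C ∧
    (∀ x, ‖x‖ ≤ 1 → χ x = 1) ∧ (∀ x, 2 ≤ ‖x‖ → χ x = 0) ∧ (∀ x, |χ x| ≤ 1) ∧
    (∀ x i, |fderiv ℝ χ x (stdVec i)| ≤ C) ∧ (∀ x, |Δ χ x| ≤ C) := by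
  let f : ContDiffBump (0 : Plane) := ⟨1, 2, by norm_num, by norm_num⟩
  have hs : HasCompactSupport f := f.hasCompactSupport
  have hc : ContDiff ℝ ∞ f := f.contDiff
  obtain ⟨C1, h1⟩ := (contDiff_laplacian hc).continuous.bounded_above_of_compact_support
    (HasCompactSupport.laplacian hs)
  have hb : ∀ i, ∃ C, ∀ x, ‖fderiv ℝ f x (stdVec i)‖ ≤ C := fun i =>
    (contDiff_fderiv_apply hc (stdVec i)).continuous.bounded_above_of_compact_support
      (hs.fderiv_apply ℝ _)
  choose C2 h2 using hb
  have hC2 : ∀ i, 0 ≤ C2 i := fun i => (norm_nonneg _).trans (h2 i 0)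
  have hC1 : 0 ≤ C1 := (norm_nonneg _).trans (h1 0)
  refine ⟨f, C1 + ∑ i, C2 i, hc, hs, add_nonneg hC1 (Finset.sum_nonneg fun i _ => hC2 i), ?_, ?_, ?_, ?_, ?_⟩
  · intro x hx
    exact f.one_of_mem_closedBall (by simpa [f] using hx)
  · intro x hx
    exact f.zero_of_le_dist (by simpa [f] using hx)
  · intro x
    rw [abs_of_nonneg f.nonneg]
    exact f.le_one
  · intro x i
    have := h2 i x
    have h3 := Finset.single_le_sum (f := C2) (fun i _ => hC2 i) (Finset.mem_univ i)
    rw [Real.norm_eq_abs] at this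
    linarith
  · intro x
    have := h1 x
    have h3 := Finset.sum_nonneg (s := Finset.univ) fun i _ => hC2 i
    rw [Real.norm_eq_abs] at this
    linarith

/-- The gradient size `‖∂₀φ‖ + ‖∂₁φ‖`. -/
def gradSize (φ : Plane → ℂ) (x : Plane) : ℝ := ∑ i, ‖fderiv ℝ φ x (stdVec i)‖

/-- The commutator of `Δ` with a cutoff at scale `1/c`. With `c → 0` it shows that cutting off at
infinity is harmless; with `c → ∞` its growth `c²` is balanced by the area of the shrinking support.
-/
lemma norm_laplacian_smul_scaled_sub_le {χ : Plane → ℝ} {φ : Plane → ℂ} {C : ℝ}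
    (hχ : ContDiff ℝ ∞ χ) (hφ : ContDiff ℝ ∞ φ) (h1 : ∀ x i, |fderiv ℝ χ x (stdVec i)| ≤ C)
    (h2 : ∀ x, |Δ χ x| ≤ C) {c : ℝ} (hc : 0 ≤ c) (x : Plane) :
    ‖Δ (fun y => χ (c • y) • φ y) x - χ (c • x) • Δ φ x‖ ≤
      C * c ^ 2 * ‖φ x‖ + 2 * C * c * gradSize φ x := by
  rw [laplacian_smul_scaled hχ hφ, add_sub_cancel_right]
  refine (norm_add_le _ _).trans (add_le_add ?_ ?_)
  · rw [norm_smul, norm_mul, Real.norm_eq_abs, Real.norm_eq_abs, abs_of_nonneg (by positivity)]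
    have := h2 (c • x)
    rw [mul_comm C]
    gcongr
  · refine (norm_sum_le _ _).trans ?_
    rw [gradSize, Finset.mul_sum]
    refine Finset.sum_le_sum fun i _ => ?_
    rw [norm_smul, norm_mul, Real.norm_eq_abs, Real.norm_eq_abs, abs_of_nonneg (by positivity)]
    have := h1 (c • x) i
    rw [show 2 * C * c = 2 * c * C by ring]
    gcongr

/-! ### Weak solutions of `-Δψ - Eψ = κδ` -/

/-- `ψ` solves `-Δψ - Eψ = κδ` in the sense of distributions. -/
def IsWeakSolution (E κ : ℂ) (ψ : Plane → ℂ) : Prop :=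
  ∀ φ : Plane → ℂ, ContDiff ℝ ∞ φ → HasCompactSupport φ →
    ∫ x, ψ x * (Δ φ x + E * φ x) = -κ * φ 0

/-- `ψ(x) = c log|x| + d + o(1)` as `x → 0`. -/
def HasLogExpansion (ψ : Plane → ℂ) (c d : ℂ) : Prop :=
  Tendsto (fun x : Plane => ψ x - c * (Real.log ‖x‖ : ℂ)) (𝓝[≠] 0) (𝓝 d)

lemma memLp_two_of_contDiff {φ : Plane → ℂ} (hφ : ContDiff ℝ ∞ φ) (h : HasCompactSupport φ) :
    MemLp φ 2 (volume : Measure Plane) :=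
  hφ.continuous.memLp_of_hasCompactSupport h

lemma contDiff_laplacian_add {φ : Plane → ℂ} (hφ : ContDiff ℝ ∞ φ) (E : ℂ) :
    ContDiff ℝ ∞ (fun x => Δ φ x + E * φ x) :=
  (contDiff_laplacian hφ).add (contDiff_const.mul hφ)

lemma hasCompactSupport_laplacian_add {φ : Plane → ℂ} (h : HasCompactSupport φ) (E : ℂ) :
    HasCompactSupport (fun x => Δ φ x + E * φ x) :=
  (HasCompactSupport.laplacian h).add (h.mul_left (f := fun _ => E))

lemma integrable_mul_of_memLp_two {f g : Plane → ℂ} (hf : MemLp f 2 volume)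
    (hg : MemLp g 2 volume) : Integrable (fun x => f x * g x) :=
  hf.integrable_mul hg

lemma integrable_mul_laplacian_add {ψ φ : Plane → ℂ} (hψ : MemLp ψ 2 volume)
    (hφ : ContDiff ℝ ∞ φ) (h : HasCompactSupport φ) (E : ℂ) :
    Integrable (fun x => ψ x * (Δ φ x + E * φ x)) :=
  integrable_mul_of_memLp_two hψ (memLp_two_of_contDiff (contDiff_laplacian_add hφ E)
    (hasCompactSupport_laplacian_add h E))

lemma laplacian_comp_clm {F G : Type*} [NormedAddCommGroup F] [NormedSpace ℝ F]
    [NormedAddCommGroup G] [NormedSpace ℝ G] {f : Plane → F} (hf : ContDiff ℝ ∞ f)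
    (l : F →L[ℝ] G) (x : Plane) : Δ (fun y => l (f y)) x = l (Δ f x) :=
  (hf.contDiffAt.of_le two_le_smooth).laplacian_CLM_comp_left (l := l)

/-- Distributions here act on real test functions; linearity in the real and imaginary parts of `φ`
recovers complex ones. -/
lemma isWeakSolution_of_real {E κ : ℂ} {ψ : Plane → ℂ} (hψ : MemLp ψ 2 volume)
    (h : ∀ g : Plane → ℝ, ContDiff ℝ ∞ g → HasCompactSupport g →
      ∫ x, ψ x * ((Δ g x : ℝ) + E * (g x : ℝ)) = -κ * (g 0 : ℝ)) : IsWeakSolution E κ ψ := by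
  intro φ hφ hc
  have e : ∀ l : ℂ →L[ℝ] ℝ, ContDiff ℝ ∞ (fun x => l (φ x)) ∧
      HasCompactSupport (fun x => l (φ x)) := fun l =>
    ⟨l.contDiff.comp hφ, hc.comp_left (g := l) (map_zero l)⟩
  have ei : ∀ l : ℂ →L[ℝ] ℝ, Integrable
      (fun x => ψ x * ((Δ (fun y => l (φ y)) x : ℝ) + E * (l (φ x) : ℝ))) := by
    intro l
    have h1 : ContDiff ℝ ∞ (fun x => ((l (φ x) : ℝ) : ℂ)) :=
      Complex.ofRealCLM.contDiff.comp (e l).1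
    have h2 : HasCompactSupport (fun x => ((l (φ x) : ℝ) : ℂ)) :=
      (e l).2.comp_left (g := fun r : ℝ => (r : ℂ)) Complex.ofReal_zero
    refine (integrable_mul_laplacian_add hψ h1 h2 E).congr (Eventually.of_forall fun x => ?_)
    have := laplacian_comp_clm (e l).1 Complex.ofRealCLM x
    simp only [Complex.ofRealCLM_apply] at this
    simp only [this]
  have hr := h _ (e Complex.reCLM).1 (e Complex.reCLM).2
  have hi := h _ (e Complex.imCLM).1 (e Complex.imCLM).2
  calc ∫ x, ψ x * (Δ φ x + E * φ x)
      = ∫ x, ((ψ x * ((Δ (fun y => Complex.reCLM (φ y)) x : ℝ) + E * (Complex.reCLM (φ x) : ℝ))) +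
        Complex.I *
          (ψ x * ((Δ (fun y => Complex.imCLM (φ y)) x : ℝ) + E * (Complex.imCLM (φ x) : ℝ)))) := by
        congr 1; ext x
        rw [laplacian_comp_clm hφ, laplacian_comp_clm hφ]
        simp only [Complex.reCLM_apply, Complex.imCLM_apply]
        conv_lhs => rw [← Complex.re_add_im (Δ φ x), ← Complex.re_add_im (φ x)]
        ring
    _ = -κ * φ 0 := by
        rw [integral_add (ei _) ((ei _).const_mul _), integral_const_mul, hr, hi]
        conv_rhs => rw [← Complex.re_add_im (φ 0)]
        simp only [Complex.reCLM_apply, Complex.imCLM_apply]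
        ring

/-- A smooth function with compact support as a test function on the whole plane. -/
def realTest (g : Plane → ℝ) (hg : ContDiff ℝ ∞ g) (hc : HasCompactSupport g) :
    𝓓((⊤ : Opens Plane), ℝ) :=
  ⟨g, hg, hc, fun _ _ => trivial⟩

lemma testLaplacian_apply {U : Opens Plane} {F : Type*} [NormedAddCommGroup F] [NormedSpace ℝ F]
    (g : 𝓓(U, F)) (x : Plane) :
    (∂_{stdVec 0} (∂_{stdVec 0} g) : 𝓓(U, F)) x + (∂_{stdVec 1} (∂_{stdVec 1} g) : 𝓓(U, F)) x =
      Δ (g : Plane → F) x := by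
  have hg : ContDiff ℝ ∞ g := g.contDiff
  have h1 : ∀ (f : 𝓓(U, F)) (v y : Plane), (∂_{v} f : 𝓓(U, F)) y = fderiv ℝ f y v := by
    intro f v y
    have hf : ContDiff ℝ ∞ f := f.contDiff
    rw [TestFunction.lineDerivOp_eq_lineDerivCLM ℝ, TestFunction.lineDerivCLM_apply_of_le (by simp),
      (hf.differentiable (by simp) y).lineDeriv_eq_fderiv]
  have h2 : ∀ v : Plane, ((∂_{v} g : 𝓓(U, F)) : Plane → F) = fun y => fderiv ℝ g y v :=
    fun v => funext fun y => h1 g v y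
  rw [laplacian_eq_sum_fderiv (hg.of_le two_le_smooth), Fin.sum_univ_two, h1, h1, h2, h2]

lemma regularDistr_apply {ψ : Plane → ℂ} (hψ : MemLp ψ 2 volume) (g : 𝓓((⊤ : Opens Plane), ℝ)) :
    regularDistr ψ g = ∫ x, ψ x * (g x : ℂ) := by
  have h : LocallyIntegrableOn ψ ((⊤ : Opens Plane) : Set Plane) volume :=
    (hψ.locallyIntegrable (by norm_num)).locallyIntegrableOn _
  refine (TestFunction.integralAgainstBilinCLM_eq_integral h).trans ?_
  congr 1; ext x
  simp [mul_comm]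

lemma distrLaplacian_regularDistr_apply {ψ : Plane → ℂ} (hψ : MemLp ψ 2 volume)
    (g : 𝓓((⊤ : Opens Plane), ℝ)) :
    distrLaplacian (regularDistr ψ) g = ∫ x, ψ x * (Δ (g : Plane → ℝ) x : ℂ) := by
  have : distrLaplacian (regularDistr ψ) g =
      regularDistr ψ (∂_{stdVec 0} (∂_{stdVec 0} g) + ∂_{stdVec 1} (∂_{stdVec 1} g)) := by
    simp [distrLaplacian, LineDeriv.lineDerivOp_neg]
  rw [this, regularDistr_apply hψ]
  congr 1; ext x
  rw [← testLaplacian_apply g x]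
  simp

/-- The normalizations make `ħ ^ 2 / (2 * m) = 1` and `log (|x| / |L|) = log |x|`, so all units
disappear and the source strength is `α d`. -/
lemma isStationaryState_iff {ħ m α L : ℝ} (h : ħ ^ 2 / m = 2) (hL : |L| = 1) (E : ℂ)
    (ψ : Plane → ℂ) :
    IsStationaryState ħ m α L E ψ ↔ MemLp ψ 2 volume ∧ ¬ (ψ =ᵐ[volume] 0) ∧
      ∃ c d : ℂ, HasLogExpansion ψ c d ∧ IsWeakSolution E (α * d) ψ := by
  have h1 : ħ ^ 2 / (2 * m) = 1 := by
    rw [mul_comm, ← div_div, h]; norm_num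
  unfold IsStationaryState IsHamiltonianApply IsDeltaProduct HasLogExpansion
  refine and_congr_right fun hψ => and_congr_right fun _ => ?_
  simp only [hL, div_one, h1, one_smul]
  have key : ∀ d : ℂ, (-(distrLaplacian (regularDistr ψ)) - α • (d • deltaZero) =
      E • regularDistr ψ) ↔ IsWeakSolution E (α * d) ψ := by
    intro d
    have ev : ∀ g : 𝓓((⊤ : Opens Plane), ℝ),
        ((-(distrLaplacian (regularDistr ψ)) - α • (d • deltaZero)) g = (E • regularDistr ψ) g) ↔
          ∫ x, ψ x * ((Δ (g : Plane → ℝ) x : ℝ) + E * (g x : ℝ)) = -(α * d) * (g 0 : ℝ) := by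
      intro g
      have hg : ContDiff ℝ ∞ (fun x => ((g x : ℝ) : ℂ)) :=
        Complex.ofRealCLM.contDiff.comp g.contDiff
      have hc : HasCompactSupport (fun x => ((g x : ℝ) : ℂ)) :=
        g.hasCompactSupport.comp_left (g := fun r : ℝ => (r : ℂ)) Complex.ofReal_zero
      have i1 : Integrable (fun x => ψ x * ((Δ (g : Plane → ℝ) x : ℝ) : ℂ)) := by
        refine (integrable_mul_of_memLp_two hψ (memLp_two_of_contDiff (contDiff_laplacian hg)
          (HasCompactSupport.laplacian hc))).congr (Eventually.of_forall fun x => ?_)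
        have := laplacian_comp_clm g.contDiff Complex.ofRealCLM x
        simp only [Complex.ofRealCLM_apply] at this
        simp only [this]
      have i2 : Integrable (fun x => ψ x * ((g x : ℝ) : ℂ)) :=
        integrable_mul_of_memLp_two hψ (memLp_two_of_contDiff hg hc)
      have e1 : (-(distrLaplacian (regularDistr ψ)) - α • (d • deltaZero)) g =
          -(∫ x, ψ x * ((Δ (g : Plane → ℝ) x : ℝ) : ℂ)) - α * (d * (g 0 : ℝ)) := by
        rw [← distrLaplacian_regularDistr_apply hψ]
        simp [deltaZero, Distribution.mapCLM_apply, Distribution.delta_apply]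
      have e2 : (E • regularDistr ψ) g = E * ∫ x, ψ x * ((g x : ℝ) : ℂ) := by
        rw [← regularDistr_apply hψ]; simp
      have e3 : ∫ x, ψ x * (((Δ (g : Plane → ℝ) x : ℝ) : ℂ) + E * (g x : ℝ)) =
          (∫ x, ψ x * ((Δ (g : Plane → ℝ) x : ℝ) : ℂ)) + E * ∫ x, ψ x * ((g x : ℝ) : ℂ) := by
        rw [← integral_const_mul, ← integral_add i1 (i2.const_mul _)]
        congr 1; ext x; ring
      rw [e1, e2, e3]
      constructor <;> intro hh <;> linear_combination -hh
    constructor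
    · intro hT
      refine isWeakSolution_of_real hψ fun g hg hc => ?_
      exact (ev (realTest g hg hc)).1 (by rw [hT])
    · intro hw
      ext g
      refine (ev g).2 ?_
      have hg : ContDiff ℝ ∞ (fun x => ((g x : ℝ) : ℂ)) :=
        Complex.ofRealCLM.contDiff.comp g.contDiff
      have hc : HasCompactSupport (fun x => ((g x : ℝ) : ℂ)) :=
        g.hasCompactSupport.comp_left (g := fun r : ℝ => (r : ℂ)) Complex.ofReal_zero
      rw [← hw _ hg hc]
      congr 1; ext x
      have := laplacian_comp_clm g.contDiff Complex.ofRealCLM x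
      simp only [Complex.ofRealCLM_apply] at this
      rw [this]
  constructor
  · rintro ⟨S, ⟨T, ⟨c, d, ht, rfl⟩, rfl⟩, hS⟩
    exact ⟨c, d, ht, (key d).1 hS⟩
  · rintro ⟨c, d, ht, hw⟩
    exact ⟨_, ⟨_, ⟨c, d, ht, rfl⟩, rfl⟩, (key d).2 hw⟩

/-- A square integrable weak solution satisfies the equation against Schwartz functions. -/
lemma IsWeakSolution.schwartz {E κ : ℂ} {ψ : Plane → ℂ} (h : IsWeakSolution E κ ψ)
    (hψ : MemLp ψ 2 volume) (φ : SchwartzMap Plane ℂ) :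
    ∫ x, ψ x * ((Δ φ) x + E * φ x) = -κ * φ 0 := by
  obtain ⟨χ, C, hχ, hχc, hC, hχ1, -, hχb, hd1, hd2⟩ := exists_cutoff
  have hφ : ContDiff ℝ ∞ φ := φ.smooth ⊤
  let c : ℕ → ℝ := fun n => 1 / ((n : ℝ) + 1)
  have hc0 : ∀ n, 0 < c n := fun n => Nat.one_div_pos_of_nat
  have hc1 : ∀ n, c n ≤ 1 := fun n => by
    have := hc0 n
    simp only [c]
    rw [div_le_one (by positivity)]
    linarith [(Nat.cast_nonneg n : (0 : ℝ) ≤ n)]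
  have hct : Tendsto c atTop (𝓝 0) := tendsto_one_div_add_atTop_nhds_zero_nat
  let Φ : ℕ → Plane → ℂ := fun n y => χ (c n • y) • φ y
  have hΦ : ∀ n, ContDiff ℝ ∞ (Φ n) := fun n => (hχ.comp (contDiff_const_smul (c n))).smul hφ
  have hΦc : ∀ n, HasCompactSupport (Φ n) := fun n =>
    HasCompactSupport.smul_right (f := fun y => χ (c n • y)) (f' := φ)
      (hχc.comp_smul (hc0 n).ne')
  have hgrad : ∀ x, gradSize φ x = ∑ i, ‖(∂_{stdVec i} φ : SchwartzMap Plane ℂ) x‖ := by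
    intro x
    simp only [gradSize, SchwartzMap.lineDerivOp_apply_eq_fderiv]
  -- Dominating function: the commutator bound with `c n ≤ 1`. It is a product of two square
  -- integrable functions.
  let bd : Plane → ℝ := fun x => ‖ψ x‖ * ((C * ‖φ x‖ + 2 * C *
    ∑ i, ‖(∂_{stdVec i} φ : SchwartzMap Plane ℂ) x‖) + ‖(Δ φ) x‖ + ‖E‖ * ‖φ x‖)
  have hbd : Integrable bd := by
    have hm : ∀ f : SchwartzMap Plane ℂ, MemLp (fun x => ‖f x‖) 2 (volume : Measure Plane) :=
      fun f => (f.memLp 2).norm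
    have hs : MemLp (fun x => ∑ i, ‖(∂_{stdVec i} φ : SchwartzMap Plane ℂ) x‖) 2
        (volume : Measure Plane) := memLp_finsetSum _ fun i _ => hm _
    exact hψ.norm.integrable_mul
      (((((hm φ).const_mul C).add (hs.const_mul (2 * C))).add (hm (Δ φ))).add
        ((hm φ).const_mul ‖E‖))
  have hlim : Tendsto (fun n => ∫ x, ψ x * (Δ (Φ n) x + E * Φ n x)) atTop
      (𝓝 (∫ x, ψ x * ((Δ φ) x + E * φ x))) := by
    refine tendsto_integral_of_dominated_convergence bd
      (fun n => (integrable_mul_laplacian_add hψ (hΦ n) (hΦc n) E).aestronglyMeasurable) hbd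
      (fun n => Eventually.of_forall fun x => ?_) (Eventually.of_forall fun x => ?_)
    · simp only [bd]
      rw [norm_mul]
      refine mul_le_mul_of_nonneg_left ?_ (norm_nonneg _)
      have h1 := norm_laplacian_smul_scaled_sub_le hχ hφ hd1 hd2 (hc0 n).le x
      have h2 : ‖χ (c n • x) • Δ (φ : Plane → ℂ) x‖ ≤ ‖(Δ φ) x‖ := by
        rw [norm_smul, Real.norm_eq_abs, SchwartzMap.laplacian_apply]
        exact mul_le_of_le_one_left (norm_nonneg _) (hχb _)
      have h3 : ‖E * Φ n x‖ ≤ ‖E‖ * ‖φ x‖ := by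
        rw [norm_mul, norm_smul, Real.norm_eq_abs]
        exact mul_le_mul_of_nonneg_left (mul_le_of_le_one_left (norm_nonneg _) (hχb _))
          (norm_nonneg _)
      have h4 : C * c n ^ 2 * ‖φ x‖ ≤ C * ‖φ x‖ := by
        have : c n ^ 2 ≤ 1 := pow_le_one₀ (hc0 n).le (hc1 n)
        refine mul_le_mul_of_nonneg_right ?_ (norm_nonneg _)
        exact mul_le_of_le_one_right hC this
      have h5 : 2 * C * c n * gradSize φ x ≤
          2 * C * ∑ i, ‖(∂_{stdVec i} φ : SchwartzMap Plane ℂ) x‖ := by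
        rw [hgrad]
        refine mul_le_mul_of_nonneg_right ?_ (Finset.sum_nonneg fun i _ => norm_nonneg _)
        exact mul_le_of_le_one_right (by positivity) (hc1 n)
      have h6 := norm_add_le (Δ (Φ n) x) (E * Φ n x)
      have h7 := norm_sub_norm_le (Δ (Φ n) x) (χ (c n • x) • Δ (φ : Plane → ℂ) x)
      linarith
    · have hev : ∀ᶠ n in atTop, ‖c n • x‖ < 1 := by
        have : Tendsto (fun n => ‖c n • x‖) atTop (𝓝 0) := by
          have := (hct.smul_const x).norm
          simpa using this
        exact this.eventually (gt_mem_nhds one_pos)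
      have hχev : ∀ᶠ n in atTop, χ (c n • x) = 1 := hev.mono fun n hn => hχ1 _ hn.le
      have h1 : Tendsto (fun n => Δ (Φ n) x - χ (c n • x) • Δ (φ : Plane → ℂ) x) atTop (𝓝 0) := by
        refine squeeze_zero_norm
          (fun n => norm_laplacian_smul_scaled_sub_le hχ hφ hd1 hd2 (hc0 n).le x) ?_
        have := ((hct.pow 2).const_mul C).mul_const ‖φ x‖ |>.add
          ((hct.const_mul (2 * C)).mul_const (gradSize φ x))
        simpa using this
      have h2 : Tendsto (fun n => Δ (Φ n) x) atTop (𝓝 ((Δ φ) x)) := by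
        have := h1.add_const ((Δ φ) x)
        rw [zero_add] at this
        refine this.congr' (hχev.mono fun n hn => ?_)
        simp [hn, SchwartzMap.laplacian_apply]
      have h3 : Tendsto (fun n => Φ n x) atTop (𝓝 (φ x)) :=
        tendsto_const_nhds.congr' (hχev.mono fun n hn => by simp [Φ, hn])
      exact (h2.add (h3.const_mul E)).const_mul _
  -- The cutoff equals one at the origin, so the right-hand side does not depend on `n`.
  have heq : ∀ n, ∫ x, ψ x * (Δ (Φ n) x + E * Φ n x) = -κ * φ 0 := by
    intro n
    rw [h _ (hΦ n) (hΦc n)]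
    simp [Φ, hχ1]
  simp only [heq] at hlim
  exact (tendsto_nhds_unique hlim tendsto_const_nhds)

/-! ### The MacDonald function -/

lemma exp_le_two_mul_cosh (t : ℝ) : Real.exp t ≤ 2 * Real.cosh t := by
  rw [Real.cosh_eq]; linarith [Real.exp_pos (-t)]

/-- From `z cosh t ≥ y` with `y = (z/2) exp t`, and `exp y ≥ y³/6`; hence `48 = 6 · 2³`. The third
power leaves decay to spare after multiplication by `t` and by `sinh t`. -/
lemma exp_neg_mul_cosh_le {z : ℝ} (hz : 0 < z) (t : ℝ) :
    Real.exp (-z * Real.cosh t) ≤ 48 / z ^ 3 * Real.exp (-3 * t) := by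
  have h1 : 0 < z / 2 * Real.exp t := by positivity
  have h2 := Real.pow_div_factorial_le_exp _ h1.le 3
  have h3 : z / 2 * Real.exp t ≤ z * Real.cosh t := by nlinarith [exp_le_two_mul_cosh t]
  have h4 : (z / 2 * Real.exp t) ^ 3 / 6 ≤ Real.exp (z * Real.cosh t) := by
    have : ((3 : ℕ).factorial : ℝ) = 6 := by norm_num [Nat.factorial]
    rw [this] at h2
    exact h2.trans (Real.exp_le_exp.2 h3)
  rw [neg_mul, Real.exp_neg, show -3 * t = -(3 * t) by ring, Real.exp_neg,
    show Real.exp (3 * t) = Real.exp t ^ 3 by rw [← Real.exp_nat_mul]; norm_num]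
  refine (inv_anti₀ (by positivity) h4).trans (le_of_eq ?_)
  field_simp
  norm_num

lemma integrableOn_exp_neg_mul_cosh {z : ℝ} (hz : 0 < z) :
    IntegrableOn (fun t => Real.exp (-z * Real.cosh t)) (Set.Ioi 0) := by
  refine Integrable.mono' ((exp_neg_integrableOn_Ioi 0 (b := 3) (by norm_num)).const_mul
    (48 / z ^ 3)) (by fun_prop) (Eventually.of_forall fun t => ?_)
  rw [Real.norm_of_nonneg (Real.exp_pos _).le]
  exact exp_neg_mul_cosh_le hz t

lemma macdonaldK0_nonneg (z : ℝ) : 0 ≤ macdonaldK0 z :=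
  integral_nonneg fun _ => (Real.exp_pos _).le

lemma exp_neg_le_inv_sqrt {y : ℝ} (hy : 0 < y) : Real.exp (-y) ≤ (√y)⁻¹ := by
  rw [Real.exp_neg]
  refine inv_anti₀ (Real.sqrt_pos.2 hy) ?_
  have := Real.add_one_le_exp y
  nlinarith [Real.sq_sqrt hy.le, Real.sqrt_nonneg y, sq_nonneg (√y - 1)]

/-- Split `z cosh t ≥ z/2 + (z/4) exp t` and apply `exp (-y) ≤ y^(-1/2)` to the second part. The
bound is weak enough to prove easily, yet its square, of order `exp (-z) / z`, is integrable on the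
plane. -/
lemma macdonaldK0_le {z : ℝ} (hz : 0 < z) :
    macdonaldK0 z ≤ 4 * (√z)⁻¹ * Real.exp (-(z / 2)) := by
  have hi : IntegrableOn (fun t => 2 * (√z)⁻¹ * Real.exp (-(z / 2)) * Real.exp (-(1 / 2) * t))
      (Set.Ioi 0) := (exp_neg_integrableOn_Ioi 0 (b := 1 / 2) (by norm_num)).const_mul _
  calc macdonaldK0 z
      ≤ ∫ t in Set.Ioi (0 : ℝ), 2 * (√z)⁻¹ * Real.exp (-(z / 2)) * Real.exp (-(1 / 2) * t) := by
        refine setIntegral_mono (integrableOn_exp_neg_mul_cosh hz) hi fun t => ?_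
        have h1 : 0 < z / 4 * Real.exp t := by positivity
        have h2 : -z * Real.cosh t ≤ -(z / 2) + -(z / 4 * Real.exp t) := by
          nlinarith [exp_le_two_mul_cosh t, Real.one_le_cosh t]
        have h3 := exp_neg_le_inv_sqrt h1
        have h4 : √(z / 4 * Real.exp t) = √z / 2 * Real.exp (t / 2) := by
          rw [Real.sqrt_mul (by positivity), Real.sqrt_div hz.le, ← Real.exp_half]
          congr 2
          rw [show (4 : ℝ) = 2 ^ 2 by norm_num]
          exact Real.sqrt_sq (by norm_num)
        calc Real.exp (-z * Real.cosh t)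
            ≤ Real.exp (-(z / 2)) * Real.exp (-(z / 4 * Real.exp t)) := by
              rw [← Real.exp_add]; exact Real.exp_le_exp.2 h2
          _ ≤ Real.exp (-(z / 2)) * (√z / 2 * Real.exp (t / 2))⁻¹ := by
              rw [← h4]; gcongr
          _ = _ := by
              rw [show -(1 / 2) * t = -(t / 2) by ring, Real.exp_neg (t / 2)]
              have := Real.sqrt_pos.2 hz
              field_simp
    _ = 4 * (√z)⁻¹ * Real.exp (-(z / 2)) := by
        rw [integral_const_mul, integral_exp_mul_Ioi (by norm_num)]
        norm_num
        ring

lemma measurable_macdonaldK0 : Measurable macdonaldK0 := by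
  have : StronglyMeasurable (fun z : ℝ => ∫ t in Set.Ioi (0 : ℝ), Real.exp (-z * Real.cosh t)) := by
    refine StronglyMeasurable.integral_prod_right (f := fun z t => Real.exp (-z * Real.cosh t)) ?_
    exact Continuous.stronglyMeasurable (by fun_prop)
  exact this.measurable

/-- Integration by parts and the substitution `v = z cosh t`. -/
lemma macdonaldK0_eq_integral_arcosh {z : ℝ} (hz : 0 < z) :
    macdonaldK0 z = ∫ v in Set.Ioi z, Real.arcosh (v / z) * Real.exp (-v) := by
  have hd : ∀ t, HasDerivAt (fun t => -Real.exp (-z * Real.cosh t))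
      (z * Real.sinh t * Real.exp (-z * Real.cosh t)) t := by
    intro t
    refine (((Real.hasDerivAt_cosh t).const_mul (-z)).exp).fun_neg.congr_deriv ?_
    ring
  have hbound : ∀ t, 0 ≤ t → t * Real.exp (-z * Real.cosh t) ≤ 48 / z ^ 3 * Real.exp (-2 * t) := by
    intro t ht
    have h1 : t ≤ Real.exp t := by linarith [Real.add_one_le_exp t]
    calc t * Real.exp (-z * Real.cosh t)
        ≤ Real.exp t * (48 / z ^ 3 * Real.exp (-3 * t)) :=
          mul_le_mul h1 (exp_neg_mul_cosh_le hz t) (Real.exp_pos _).le (Real.exp_pos _).le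
      _ = _ := by rw [show -2 * t = t + -3 * t by ring, Real.exp_add]; ring
  have hint : IntegrableOn (fun t => t * (z * Real.sinh t * Real.exp (-z * Real.cosh t)))
      (Set.Ioi 0) := by
    refine Integrable.mono' ((exp_neg_integrableOn_Ioi 0 (b := 1) (by norm_num)).const_mul
      (z * (48 / z ^ 3))) (by fun_prop) ((ae_restrict_mem measurableSet_Ioi).mono fun t ht => ?_)
    have ht : 0 < t := ht
    have hs : 0 ≤ Real.sinh t := Real.sinh_nonneg_iff.2 ht.le
    have hs' : Real.sinh t ≤ Real.exp t := by
      rw [Real.sinh_eq]; linarith [Real.exp_pos (-t), Real.exp_pos t]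
    rw [Real.norm_of_nonneg (by positivity)]
    calc t * (z * Real.sinh t * Real.exp (-z * Real.cosh t))
        = z * (Real.sinh t * (t * Real.exp (-z * Real.cosh t))) := by ring
      _ ≤ z * (Real.exp t * (48 / z ^ 3 * Real.exp (-2 * t))) := by
          refine mul_le_mul_of_nonneg_left ?_ hz.le
          exact mul_le_mul hs' (hbound t ht.le) (by positivity) (Real.exp_pos _).le
      _ = _ := by rw [show -1 * t = t + -2 * t by ring, Real.exp_add]; ring
  -- Both boundary terms of `-t exp (-z cosh t)` vanish: at `0` because of the factor `t`, at
  -- infinity by `hbound`.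
  have hparts := integral_Ioi_mul_deriv_eq_deriv_mul (a := (0 : ℝ)) (u := fun t : ℝ => t)
    (u' := fun _ => 1) (v := fun t => -Real.exp (-z * Real.cosh t))
    (v' := fun t => z * Real.sinh t * Real.exp (-z * Real.cosh t)) (a' := 0) (b' := 0)
    (fun t _ => hasDerivAt_id t) (fun t _ => hd t) hint
    (by
      have := (integrableOn_exp_neg_mul_cosh hz).neg
      refine this.congr_fun (fun t _ => ?_) measurableSet_Ioi
      simp)
    (by
      have : Continuous (fun t => t * -Real.exp (-z * Real.cosh t)) := by fun_prop
      have := (this.tendsto 0).mono_left (nhdsWithin_le_nhds (s := Set.Ioi 0))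
      rw [zero_mul] at this
      exact this)
    (by
      have h0 : Tendsto (fun t => 48 / z ^ 3 * Real.exp (-2 * t)) atTop (𝓝 0) := by
        have : Tendsto (fun t : ℝ => -2 * t) atTop atBot :=
          tendsto_id.const_mul_atTop_of_neg (by norm_num)
        simpa using (Real.tendsto_exp_atBot.comp this).const_mul (48 / z ^ 3)
      refine squeeze_zero_norm' ?_ h0
      filter_upwards [eventually_ge_atTop 0] with t ht
      simp only [Pi.mul_apply]
      rw [mul_neg, norm_neg, Real.norm_of_nonneg (by positivity)]
      exact hbound t ht)
  have himg : (fun t => z * Real.cosh t) '' Set.Ioi 0 = Set.Ioi z := by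
    ext v
    simp only [Set.mem_image, Set.mem_Ioi]
    constructor
    · rintro ⟨t, ht, rfl⟩
      have := Real.one_lt_cosh.2 ht.ne'
      nlinarith
    · intro hv
      have h1 : 1 < v / z := by rwa [lt_div_iff₀ hz, one_mul]
      exact ⟨Real.arcosh (v / z), Real.arcosh_pos h1, by
        rw [Real.cosh_arcosh h1.le]; field_simp⟩
  have hsub := integral_image_eq_integral_abs_deriv_smul (s := Set.Ioi (0 : ℝ))
    (f := fun t => z * Real.cosh t) (f' := fun t => z * Real.sinh t) measurableSet_Ioi
    (fun t _ => ((Real.hasDerivAt_cosh t).const_mul z).hasDerivWithinAt)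
    (by
      intro s hs t ht hst
      have : Real.cosh s = Real.cosh t := mul_left_cancel₀ hz.ne' hst
      have hs : 0 < s := hs
      have ht : 0 < t := ht
      rw [← Real.arcosh_cosh hs.le, ← Real.arcosh_cosh ht.le, this])
    (fun v => Real.arcosh (v / z) * Real.exp (-v))
  rw [himg] at hsub
  rw [hsub]
  have e1 : ∫ t in Set.Ioi (0 : ℝ), |z * Real.sinh t| •
      (Real.arcosh (z * Real.cosh t / z) * Real.exp (-(z * Real.cosh t))) =
      ∫ t in Set.Ioi (0 : ℝ), t * (z * Real.sinh t * Real.exp (-z * Real.cosh t)) := by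
    refine setIntegral_congr_fun measurableSet_Ioi fun t ht => ?_
    have ht : 0 < t := ht
    have hs : 0 ≤ Real.sinh t := Real.sinh_nonneg_iff.2 ht.le
    simp only [smul_eq_mul]
    rw [abs_of_nonneg (by positivity), mul_div_cancel_left₀ _ hz.ne', Real.arcosh_cosh ht.le]
    rw [neg_mul]; ring
  rw [e1, hparts]
  simp only [one_mul, integral_neg, macdonaldK0]
  ring

/-- This is `Γ'(1) = -γ`, with Euler's integral differentiated under the integral sign. It is where
`γ` enters. -/
lemma integral_log_mul_exp_neg :
    ∫ t in Set.Ioi (0 : ℝ), Real.log t * Real.exp (-t) = -Real.eulerMascheroniConstant := by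
  have h1 := Complex.hasDerivAt_GammaIntegral (s := 1) (by simp)
  have h2 : HasDerivAt Complex.Gamma (-(Real.eulerMascheroniConstant : ℂ)) 1 := by
    simpa using Complex.hasDerivAt_Gamma_nat 0
  have h3 : Complex.Gamma =ᶠ[𝓝 1] Complex.GammaIntegral := by
    have : ∀ᶠ s : ℂ in 𝓝 1, 0 < s.re :=
      Complex.continuous_re.continuousAt.eventually (lt_mem_nhds (by simp))
    exact this.mono fun s hs => Complex.Gamma_eq_integral hs
  have h4 := h1.unique (h2.congr_of_eventuallyEq h3.symm)
  simp only [sub_self, Complex.cpow_zero, one_mul] at h4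
  have h5 : ((∫ t in Set.Ioi (0 : ℝ), Real.log t * Real.exp (-t) : ℝ) : ℂ) =
      -(Real.eulerMascheroniConstant : ℂ) := by
    rw [← h4, ← integral_complex_ofReal]
    congr 1; ext t; push_cast; ring
  exact_mod_cast h5

/-- A non-integrable function has integral `0` by convention, whereas this integral is `-γ ≠ 0`. -/
lemma integrableOn_log_mul_exp_neg :
    IntegrableOn (fun t => Real.log t * Real.exp (-t)) (Set.Ioi 0) := by
  by_contra h
  have := integral_undef h
  rw [integral_log_mul_exp_neg] at this
  have := Real.one_half_lt_eulerMascheroniConstant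
  linarith

/-- From `arcosh y = log (y + √(y² - 1))`. Adding `log z` removes the singularity: the right-hand
side tends to `log (2v)` as `z → 0`. -/
lemma arcosh_div_add_log {v z : ℝ} (hz : 0 < z) (hv : z < v) :
    Real.arcosh (v / z) + Real.log z = Real.log (v + √(v ^ 2 - z ^ 2)) := by
  have h1 : 1 ≤ v / z := by rw [le_div_iff₀ hz]; linarith
  have h2 : √((v / z) ^ 2 - 1) = √(v ^ 2 - z ^ 2) / z := by
    rw [show (v / z) ^ 2 - 1 = (v ^ 2 - z ^ 2) / z ^ 2 by field_simp, Real.sqrt_div',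
      Real.sqrt_sq hz.le]
    positivity
  rw [Real.arcosh, h2, ← Real.log_mul _ hz.ne']
  · congr 1; field_simp
  · have : 0 < v / z := by linarith
    positivity

lemma macdonaldK0_pos {z : ℝ} (hz : 0 < z) : 0 < macdonaldK0 z := by
  refine (setIntegral_pos_iff_support_of_nonneg_ae
    (Eventually.of_forall fun t => (Real.exp_pos _).le) (integrableOn_exp_neg_mul_cosh hz)).2 ?_
  have : Function.support (fun t => Real.exp (-z * Real.cosh t)) = Set.univ := by
    ext t; simp
  rw [this]; simp

/-- `K₀(z) = -log (z / 2) - γ + o(1)` as `z → 0`. -/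
lemma tendsto_macdonaldK0_add_log :
    Tendsto (fun z => macdonaldK0 z + Real.log z) (𝓝[>] 0)
      (𝓝 (Real.log 2 - Real.eulerMascheroniConstant)) := by
  -- The indicator moves the `z`-dependent domain into the integrand, so that dominated convergence
  -- applies on `(0, ∞)`. Since `v ≤ v + √(v² - z²) ≤ 2v`, the logarithm lies between `log v` and
  -- `log 2 + log v`.
  let F : ℝ → ℝ → ℝ := fun z => Set.indicator (Set.Ioi z)
    fun v => Real.log (v + √(v ^ 2 - z ^ 2)) * Real.exp (-v)
  have hexp : IntegrableOn (fun v => Real.exp (-v)) (Set.Ioi 0) := by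
    simpa using exp_neg_integrableOn_Ioi 0 (b := 1) one_pos
  have hF : Tendsto (fun z => ∫ v in Set.Ioi (0 : ℝ), F z v) (𝓝[>] 0)
      (𝓝 (∫ v in Set.Ioi (0 : ℝ), Real.log (2 * v) * Real.exp (-v))) := by
    refine tendsto_integral_filter_of_dominated_convergence
      (fun v => |Real.log v * Real.exp (-v)| + Real.log 2 * Real.exp (-v)) ?_ ?_ ?_ ?_
    · refine Eventually.of_forall fun z => ?_
      refine (Measurable.indicator ?_ measurableSet_Ioi).aestronglyMeasurable
      fun_prop
    · filter_upwards [self_mem_nhdsWithin] with z (hz : 0 < z)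
      refine (ae_restrict_mem measurableSet_Ioi).mono fun v (hv : 0 < v) => ?_
      have hl2 : 0 ≤ Real.log 2 := Real.log_nonneg (by norm_num)
      by_cases h : z < v
      · simp only [F, Set.indicator_of_mem (Set.mem_Ioi.2 h)]
        rw [norm_mul, Real.norm_eq_abs, Real.norm_eq_abs, abs_mul, abs_of_pos (Real.exp_pos (-v)), ← add_mul]
        refine mul_le_mul_of_nonneg_right ?_ (Real.exp_pos _).le
        have h1 : √(v ^ 2 - z ^ 2) ≤ v := by
          rw [Real.sqrt_le_left hv.le]; nlinarith
        have h2 : Real.log v ≤ Real.log (v + √(v ^ 2 - z ^ 2)) :=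
          Real.log_le_log hv (by linarith [Real.sqrt_nonneg (v ^ 2 - z ^ 2)])
        have h3 : Real.log (v + √(v ^ 2 - z ^ 2)) ≤ Real.log 2 + Real.log v := by
          rw [← Real.log_mul (by norm_num) hv.ne']
          exact Real.log_le_log (by positivity) (by linarith)
        rw [abs_le]
        constructor
        · linarith [neg_abs_le (Real.log v)]
        · linarith [le_abs_self (Real.log v)]
      · simp only [F, Set.indicator_of_notMem (by simpa using h : v ∉ Set.Ioi z)]
        rw [norm_zero]; positivity
    · exact integrableOn_log_mul_exp_neg.abs.add (hexp.const_mul _)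
    · refine (ae_restrict_mem measurableSet_Ioi).mono fun v (hv : 0 < v) => ?_
      have hc : Tendsto (fun z : ℝ => Real.log (v + √(v ^ 2 - z ^ 2)) * Real.exp (-v)) (𝓝[>] 0)
          (𝓝 (Real.log (2 * v) * Real.exp (-v))) := by
        have : ContinuousAt (fun z : ℝ => Real.log (v + √(v ^ 2 - z ^ 2)) * Real.exp (-v)) 0 := by
          refine ContinuousAt.mul (ContinuousAt.log (by fun_prop) ?_) continuousAt_const
          positivity
        have h := this.tendsto.mono_left (nhdsWithin_le_nhds (s := Set.Ioi 0))
        have e : v + √(v ^ 2 - 0 ^ 2) = 2 * v := by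
          rw [show v ^ 2 - 0 ^ 2 = v ^ 2 by ring, Real.sqrt_sq hv.le]; ring
        rwa [e] at h
      refine hc.congr' ?_
      have : ∀ᶠ z : ℝ in 𝓝[>] 0, z < v := nhdsWithin_le_nhds (gt_mem_nhds hv)
      filter_upwards [this] with z hz
      simp only [F, Set.indicator_of_mem (Set.mem_Ioi.2 hz)]
  have hlim : ∫ v in Set.Ioi (0 : ℝ), Real.log (2 * v) * Real.exp (-v) =
      Real.log 2 - Real.eulerMascheroniConstant := by
    have : ∫ v in Set.Ioi (0 : ℝ), Real.log (2 * v) * Real.exp (-v) =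
        ∫ v in Set.Ioi (0 : ℝ), (Real.log 2 * Real.exp (-v) + Real.log v * Real.exp (-v)) := by
      refine setIntegral_congr_fun measurableSet_Ioi fun v (hv : 0 < v) => ?_
      rw [Real.log_mul (by norm_num) hv.ne']; ring
    rw [this, integral_add (hexp.const_mul _) integrableOn_log_mul_exp_neg, integral_const_mul,
      integral_log_mul_exp_neg, integral_exp_neg_Ioi_zero]
    ring
  -- Integrating `log z · exp (-v)` over `(z, ∞)` gives `log z · exp (-z)` instead of `log z`; the
  -- discrepancy is at most `|z log z|`.
  have hlog : Tendsto (fun z => Real.log z * (1 - Real.exp (-z))) (𝓝[>] 0) (𝓝 0) := by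
    have h0 : Tendsto (fun z : ℝ => |Real.log z * z|) (𝓝[>] 0) (𝓝 0) := by
      have := (tendsto_log_mul_rpow_nhdsGT_zero one_pos).abs
      simpa only [Real.rpow_one, abs_zero] using this
    refine squeeze_zero_norm' ?_ h0
    filter_upwards [self_mem_nhdsWithin] with z (hz : 0 < z)
    rw [norm_mul, abs_mul, Real.norm_eq_abs, Real.norm_eq_abs]
    refine mul_le_mul_of_nonneg_left ?_ (abs_nonneg _)
    have h1 : Real.exp (-z) ≤ 1 := Real.exp_le_one_iff.2 (by linarith)
    have h2 := Real.add_one_le_exp (-z)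
    rw [abs_of_nonneg (by linarith), abs_of_pos hz]
    linarith
  have hsum := hF.add hlog
  rw [hlim, add_zero] at hsum
  refine hsum.congr' ?_
  filter_upwards [self_mem_nhdsWithin] with z (hz : 0 < z)
  have hez : ∫ v in Set.Ioi z, Real.exp (-v) = Real.exp (-z) := integral_exp_neg_Ioi z
  have hi1 : IntegrableOn (fun v => Real.log z * Real.exp (-v)) (Set.Ioi z) :=
    (hexp.mono_set (Set.Ioi_subset_Ioi hz.le)).const_mul _
  have hF' : ∫ v in Set.Ioi (0 : ℝ), F z v =
      ∫ v in Set.Ioi z, (Real.arcosh (v / z) * Real.exp (-v) + Real.log z * Real.exp (-v)) := by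
    rw [setIntegral_indicator measurableSet_Ioi,
      Set.inter_eq_self_of_subset_right (Set.Ioi_subset_Ioi hz.le)]
    refine setIntegral_congr_fun measurableSet_Ioi fun v hv => ?_
    rw [← add_mul, arcosh_div_add_log hz hv]
  have hi2 : IntegrableOn (fun v => Real.arcosh (v / z) * Real.exp (-v)) (Set.Ioi z) := by
    by_contra h
    have h0 := integral_undef h
    rw [← macdonaldK0_eq_integral_arcosh hz] at h0
    have hpos := macdonaldK0_pos hz
    linarith
  rw [hF', integral_add hi2 hi1, integral_const_mul, hez, ← macdonaldK0_eq_integral_arcosh hz]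
  ring

/-- The heat kernel representation of `K₀`. -/
lemma macdonaldK0_eq_integral_heat {b r : ℝ} (hb : 0 < b) (hr : 0 < r) :
    macdonaldK0 (b * r) =
      ∫ s in Set.Ioi (0 : ℝ), (2 * s)⁻¹ * Real.exp (-(b ^ 2 * s) - r ^ 2 / (4 * s)) := by
  have h1 : 2 * macdonaldK0 (b * r) = ∫ t : ℝ, Real.exp (-(b * r) * Real.cosh t) := by
    rw [macdonaldK0, ← integral_comp_abs]
    simp only [Real.cosh_abs]
  -- The substitution `s = (r / 2b) exp t` turns `b² s` and `r² / 4s` into `(br/2) exp (±t)`, whose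
  -- sum is `br cosh t`; also `ds / 2s = dt / 2`.
  have hk : 0 < r / (2 * b) := by positivity
  have himg : (fun t => r / (2 * b) * Real.exp t) '' Set.univ = Set.Ioi 0 := by
    ext v
    simp only [Set.mem_image, Set.mem_univ, true_and, Set.mem_Ioi]
    constructor
    · rintro ⟨t, rfl⟩
      positivity
    · intro hv
      refine ⟨Real.log (v / (r / (2 * b))), ?_⟩
      rw [Real.exp_log (by positivity)]
      field_simp
  have hsub := integral_image_eq_integral_abs_deriv_smul (s := Set.univ)
    (f := fun t => r / (2 * b) * Real.exp t) (f' := fun t => r / (2 * b) * Real.exp t)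
    MeasurableSet.univ
    (fun t _ => ((Real.hasDerivAt_exp t).const_mul _).hasDerivWithinAt)
    (fun s _ t _ hst => Real.exp_injective (mul_left_cancel₀ hk.ne' hst))
    (fun s => (2 * s)⁻¹ * Real.exp (-(b ^ 2 * s) - r ^ 2 / (4 * s)))
  rw [himg] at hsub
  rw [hsub, setIntegral_univ]
  have h2 : ∀ t : ℝ, |r / (2 * b) * Real.exp t| • ((2 * (r / (2 * b) * Real.exp t))⁻¹ *
      Real.exp (-(b ^ 2 * (r / (2 * b) * Real.exp t)) - r ^ 2 / (4 * (r / (2 * b) * Real.exp t)))) =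
      1 / 2 * Real.exp (-(b * r) * Real.cosh t) := by
    intro t
    have he := Real.exp_pos t
    rw [abs_of_pos (by positivity), smul_eq_mul, ← mul_assoc]
    congr 1
    · field_simp
    · congr 1
      rw [Real.cosh_eq, Real.exp_neg]
      field_simp
      ring
  simp only [h2]
  rw [integral_const_mul, ← h1]
  ring

/-! ### The Green function of `-Δ + b²` -/

/-- The symbol `4π²|ξ|²` of `-Δ`. -/
def symb (ξ : Plane) : ℝ := (2 * Real.pi) ^ 2 * ‖ξ‖ ^ 2

lemma symb_nonneg (ξ : Plane) : 0 ≤ symb ξ := by unfold symb; positivity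

lemma continuous_symb : Continuous symb := by unfold symb; fun_prop

lemma fourier_laplacian_add (φ : SchwartzMap Plane ℂ) (E : ℂ) (ξ : Plane) :
    (𝓕 (Δ φ + E • φ) : SchwartzMap Plane ℂ) ξ =
      (E - symb ξ) * (𝓕 φ : SchwartzMap Plane ℂ) ξ := by
  have h1 : (𝓕 (Δ φ) : SchwartzMap Plane ℂ) =
      -(2 * Real.pi) ^ 2 • SchwartzMap.smulLeftCLM ℂ (fun x : Plane => ‖x‖ ^ 2) (𝓕 φ) := by
    rw [SchwartzMap.laplacian_eq_fourierMultiplierCLM, SchwartzMap.fourierMultiplierCLM_apply,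
      ← FourierTransform.fourierInv_smul, FourierTransform.fourier_fourierInv_eq]
  have h2 : Function.HasTemperateGrowth (fun x : Plane => ‖x‖ ^ 2) := by fun_prop
  rw [FourierTransform.fourier_add, FourierTransform.fourier_smul, h1]
  simp only [_root_.add_apply, _root_.smul_apply, smul_eq_mul]
  rw [SchwartzMap.smulLeftCLM_apply_apply h2]
  simp only [symb, Complex.real_smul]
  push_cast
  ring

lemma schwartz_apply_zero_eq_integral_fourier (φ : SchwartzMap Plane ℂ) :
    φ 0 = ∫ ξ, (𝓕 φ : SchwartzMap Plane ℂ) ξ := by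
  have h : φ = 𝓕⁻ (𝓕 φ : SchwartzMap Plane ℂ) := (FourierTransform.fourierInv_fourier_eq φ).symm
  conv_lhs => rw [h, SchwartzMap.fourierInv_coe, Real.fourierInv_eq]
  simp

/-- The Fourier transform is symmetric for an integrable function against a Schwartz function. -/
lemma integral_fourier_mul_schwartz {f : Plane → ℂ} (hf : Integrable f)
    (u : SchwartzMap Plane ℂ) :
    ∫ x, 𝓕 f x * u x = ∫ ξ, f ξ * (𝓕 u : SchwartzMap Plane ℂ) ξ := by
  have h := VectorFourier.integral_fourierIntegral_smul_eq_flip (𝕜 := ℝ) (μ := volume)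
    (ν := volume) (L := innerₗ Plane) (f := f) (g := u) Real.continuous_fourierChar
    (by simpa using continuous_inner) hf u.integrable
  rw [flip_innerₗ] at h
  exact h

/-- The heat kernel on the plane. -/
def heatKernel (s : ℝ) (x : Plane) : ℝ := (4 * Real.pi * s)⁻¹ * Real.exp (-(‖x‖ ^ 2 / (4 * s)))

/-- The heat kernel is the Fourier transform of the Gaussian `exp (-s · symb)`, and the transform is
symmetric under the pairing. -/
lemma integral_heatKernel_mul {s : ℝ} (hs : 0 < s) (u : SchwartzMap Plane ℂ) :
    ∫ x, (heatKernel s x : ℂ) * u x =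
      ∫ ξ, (Real.exp (-(s * symb ξ)) : ℂ) * (𝓕 u : SchwartzMap Plane ℂ) ξ := by
  have hpi := Real.pi_pos
  have hb : 0 < (((2 * Real.pi) ^ 2 * s : ℝ) : ℂ).re := by
    rw [Complex.ofReal_re]; positivity
  have hg : ∀ ξ : Plane, (Real.exp (-(s * symb ξ)) : ℂ) =
      Complex.exp (-(((2 * Real.pi) ^ 2 * s : ℝ) : ℂ) * (‖ξ‖ : ℂ) ^ 2) := by
    intro ξ
    simp only [symb]; push_cast; congr 1; ring
  have hi : Integrable fun ξ : Plane =>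
      Complex.exp (-(((2 * Real.pi) ^ 2 * s : ℝ) : ℂ) * (‖ξ‖ : ℂ) ^ 2) := by
    simpa using GaussianFourier.integrable_cexp_neg_mul_sq_norm_add hb 0 (0 : Plane)
  simp only [hg]
  rw [← integral_fourier_mul_schwartz hi]
  congr 1; ext x
  rw [fourier_gaussian_innerProductSpace hb]
  congr 1
  have hfr : Module.finrank ℝ Plane = 2 := by simp
  rw [hfr]
  simp only [heatKernel]
  norm_num
  have hpc : (Real.pi : ℂ) ≠ 0 := by exact_mod_cast hpi.ne'
  have hsc : (s : ℂ) ≠ 0 := by exact_mod_cast hs.ne'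
  congr 1
  · field_simp
    norm_num
  · congr 1
    field_simp
    norm_num

/-- The Green function `K₀(b|x|) / 2π` of `-Δ + b²`. -/
def greenFn (b : ℝ) (x : Plane) : ℝ := macdonaldK0 (b * ‖x‖) / (2 * Real.pi)

lemma greenFn_nonneg (b : ℝ) (x : Plane) : 0 ≤ greenFn b x :=
  div_nonneg (macdonaldK0_nonneg _) (by positivity)

lemma measurable_greenFn (b : ℝ) : Measurable (greenFn b) :=
  (measurable_macdonaldK0.comp (by fun_prop)).div_const _

lemma greenFn_pos {b : ℝ} (hb : 0 < b) {x : Plane} (hx : x ≠ 0) : 0 < greenFn b x :=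
  div_pos (macdonaldK0_pos (mul_pos hb (norm_pos_iff.2 hx))) (by positivity)

/-- The resolvent as the Laplace transform of the heat semigroup: `(-Δ + b²)⁻¹ = ∫₀^∞ exp (-b² s)
exp (sΔ) ds`. -/
lemma greenFn_eq_integral {b : ℝ} (hb : 0 < b) {x : Plane} (hx : x ≠ 0) :
    greenFn b x = ∫ s in Set.Ioi (0 : ℝ), Real.exp (-(b ^ 2 * s)) * heatKernel s x := by
  rw [greenFn, macdonaldK0_eq_integral_heat hb (norm_pos_iff.2 hx), ← integral_div]
  refine setIntegral_congr_fun measurableSet_Ioi fun s (hs : 0 < s) => ?_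
  simp only [heatKernel]
  rw [sub_eq_add_neg, Real.exp_add]
  field_simp
  norm_num

/-- The integral is positive by `greenFn_pos`, so it is not the default value `0`. -/
lemma integrableOn_exp_mul_heatKernel {b : ℝ} (hb : 0 < b) {x : Plane} (hx : x ≠ 0) :
    IntegrableOn (fun s => Real.exp (-(b ^ 2 * s)) * heatKernel s x) (Set.Ioi 0) := by
  by_contra h
  have h0 := integral_undef h
  rw [← greenFn_eq_integral hb hx] at h0
  exact (greenFn_pos hb hx).ne' h0

lemma ae_ne_zero_plane : ∀ᵐ x : Plane, x ≠ 0 := by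
  simp [ae_iff, measure_singleton]

lemma memLp_greenFn {b : ℝ} (hb : 0 < b) :
    MemLp (fun x => (greenFn b x : ℂ)) 2 (volume : Measure Plane) := by
  have hm : AEStronglyMeasurable (fun x => (greenFn b x : ℂ)) (volume : Measure Plane) :=
    (Complex.measurable_ofReal.comp (measurable_greenFn b)).aestronglyMeasurable
  rw [memLp_two_iff_integrable_sq_norm hm]
  -- In polar coordinates the area element `r dr` cancels the factor `1/r`.
  have hi : Integrable (fun x : Plane => (b * ‖x‖)⁻¹ * Real.exp (-(b * ‖x‖))) := by
    rw [integrable_fun_norm_addHaar (volume : Measure Plane)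
      (f := fun r => (b * r)⁻¹ * Real.exp (-(b * r)))]
    have hfr : Module.finrank ℝ Plane = 2 := by simp
    rw [hfr]
    have h : IntegrableOn (fun r => b⁻¹ * Real.exp (-b * r)) (Set.Ioi 0) :=
      (exp_neg_integrableOn_Ioi 0 hb).const_mul b⁻¹
    refine h.congr_fun (fun r (hr : 0 < r) => ?_) measurableSet_Ioi
    simp only [smul_eq_mul]
    rw [neg_mul]
    field_simp
    norm_num
  refine (hi.const_mul ((4 / (2 * Real.pi)) ^ 2)).mono' (hm.norm.pow 2) ?_
  filter_upwards [ae_ne_zero_plane] with x hx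
  have hz : 0 < b * ‖x‖ := mul_pos hb (norm_pos_iff.2 hx)
  have h1 := macdonaldK0_le hz
  have h2 : ‖(greenFn b x : ℂ)‖ = greenFn b x := by
    rw [Complex.norm_real, Real.norm_of_nonneg (greenFn_nonneg b x)]
  rw [h2, Real.norm_of_nonneg (by positivity)]
  calc greenFn b x ^ 2 ≤ (4 * (√(b * ‖x‖))⁻¹ * Real.exp (-(b * ‖x‖ / 2)) / (2 * Real.pi)) ^ 2 := by
        refine pow_le_pow_left₀ (greenFn_nonneg b x) ?_ 2
        exact div_le_div_of_nonneg_right h1 (by positivity)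
    _ = (4 / (2 * Real.pi)) ^ 2 * (((√(b * ‖x‖)) ^ 2)⁻¹ * Real.exp (-(b * ‖x‖ / 2)) ^ 2) := by
        ring
    _ = _ := by
        rw [Real.sq_sqrt hz.le, ← Real.exp_nat_mul]
        congr 3
        push_cast; ring

/-- `K₀(b|x|) / 2π = -(1 / 2π) log|x| + (log 2 - γ - log b) / 2π + o(1)`. -/
lemma hasLogExpansion_greenFn {b : ℝ} (hb : 0 < b) :
    HasLogExpansion (fun x => (greenFn b x : ℂ)) ((-1 / (2 * Real.pi) : ℝ) : ℂ)
      (((Real.log 2 - Real.eulerMascheroniConstant - Real.log b) / (2 * Real.pi) : ℝ) : ℂ) := by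
  have h1 : Tendsto (fun x : Plane => b * ‖x‖) (𝓝[≠] 0) (𝓝[>] 0) := by
    refine tendsto_nhdsWithin_iff.2 ⟨?_, ?_⟩
    · have : Continuous fun x : Plane => b * ‖x‖ := by fun_prop
      have h := (this.tendsto 0).mono_left (nhdsWithin_le_nhds (s := {0}ᶜ))
      simpa using h
    · filter_upwards [self_mem_nhdsWithin] with x hx
      exact mul_pos hb (norm_pos_iff.2 hx)
  have h2 := (((tendsto_macdonaldK0_add_log.comp h1).sub_const (Real.log b)).div_const
    (2 * Real.pi))
  have h3 := (Complex.continuous_ofReal.tendsto _).comp h2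
  refine h3.congr' ?_
  filter_upwards [self_mem_nhdsWithin] with x hx
  have hx' : 0 < ‖x‖ := norm_pos_iff.2 hx
  simp only [Function.comp_apply, greenFn]
  rw [Real.log_mul hb.ne' hx'.ne', ← Complex.ofReal_mul, ← Complex.ofReal_sub]
  congr 1
  ring

/-- `(-Δ + b²) K₀(b|x|) / 2π = δ`, tested against Schwartz functions. -/
lemma integral_greenFn_mul {b : ℝ} (hb : 0 < b) (φ : SchwartzMap Plane ℂ) :
    ∫ x, (greenFn b x : ℂ) * ((Δ φ) x + (-(b ^ 2 : ℝ) : ℂ) * φ x) = -φ 0 := by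
  set u : SchwartzMap Plane ℂ := Δ φ + (-(b ^ 2 : ℝ) : ℂ) • φ with hu
  have hu' : ∀ x, (Δ φ) x + (-(b ^ 2 : ℝ) : ℂ) * φ x = u x := fun x => by simp [hu]
  simp only [hu']
  let μ : Measure ℝ := volume.restrict (Set.Ioi 0)
  let A : ℝ × Plane → ℂ := fun p => ((Real.exp (-(b ^ 2 * p.1)) * heatKernel p.1 p.2 : ℝ) : ℂ) * u p.2
  have hpos : ∀ (s : ℝ), 0 < s → ∀ x, 0 ≤ Real.exp (-(b ^ 2 * s)) * heatKernel s x := by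
    intro s hs x
    have := Real.pi_pos
    unfold heatKernel; positivity
  have hAm : AEStronglyMeasurable A (μ.prod volume) := by
    have h1 : Measurable fun p : ℝ × Plane => Real.exp (-(b ^ 2 * p.1)) * heatKernel p.1 p.2 := by
      unfold heatKernel; fun_prop
    have h2 : Measurable fun p : ℝ × Plane => u p.2 := u.continuous.measurable.comp measurable_snd
    exact ((Complex.measurable_ofReal.comp h1).mul h2).aestronglyMeasurable
  -- The kernel is positive, so integrating `‖A‖` over `s` gives `greenFn b x * ‖u x‖`, a product of
  -- square integrable functions.
  have hAi : Integrable A (μ.prod volume) := by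
    rw [integrable_prod_iff' hAm]
    constructor
    · filter_upwards [ae_ne_zero_plane] with x hx
      have h : Integrable (fun s => Real.exp (-(b ^ 2 * s)) * heatKernel s x) μ :=
        integrableOn_exp_mul_heatKernel hb hx
      exact (h.ofReal (𝕜 := ℂ)).mul_const (u x)
    · have h1 : Integrable fun x => ‖(greenFn b x : ℂ) * u x‖ :=
        (integrable_mul_of_memLp_two (memLp_greenFn hb) (u.memLp 2)).norm
      refine h1.congr ?_
      filter_upwards [ae_ne_zero_plane] with x hx
      rw [norm_mul, Complex.norm_real, Real.norm_of_nonneg (greenFn_nonneg b x),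
        greenFn_eq_integral hb hx, ← integral_mul_const]
      refine setIntegral_congr_fun measurableSet_Ioi fun s (hs : 0 < s) => ?_
      simp only [A]
      rw [norm_mul, Complex.norm_real, Real.norm_of_nonneg (hpos s hs x)]
  let B : ℝ → Plane → ℂ := fun s ξ =>
    ((Real.exp (-(b ^ 2 * s)) * Real.exp (-(s * symb ξ)) : ℝ) : ℂ) *
      (𝓕 u : SchwartzMap Plane ℂ) ξ
  have hPpos : ∀ ξ, 0 < symb ξ + b ^ 2 := fun ξ => by
    have := symb_nonneg ξ; positivity
  have hBexp : ∀ s ξ, Real.exp (-(b ^ 2 * s)) * Real.exp (-(s * symb ξ)) =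
      Real.exp (-(symb ξ + b ^ 2) * s) := by
    intro s ξ; rw [← Real.exp_add]; congr 1; ring
  have hBint : ∀ ξ, ∫ s in Set.Ioi (0 : ℝ), Real.exp (-(symb ξ + b ^ 2) * s) =
      (symb ξ + b ^ 2)⁻¹ := by
    intro ξ
    rw [integral_exp_mul_Ioi (by linarith [hPpos ξ]), mul_zero, Real.exp_zero, neg_div_neg_eq,
      one_div]
  have hFu : ∀ ξ, (𝓕 u : SchwartzMap Plane ℂ) ξ =
      -((symb ξ + b ^ 2 : ℝ) : ℂ) * (𝓕 φ : SchwartzMap Plane ℂ) ξ := by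
    intro ξ
    rw [hu, fourier_laplacian_add]
    push_cast; ring
  have hBm : AEStronglyMeasurable (Function.uncurry B) (μ.prod volume) := by
    have h0 := continuous_symb
    have h2 : Continuous fun p : ℝ × Plane => (𝓕 u : SchwartzMap Plane ℂ) p.2 :=
      (𝓕 u : SchwartzMap Plane ℂ).continuous.comp continuous_snd
    refine Continuous.aestronglyMeasurable ?_
    refine Continuous.mul (Complex.continuous_ofReal.comp ?_) h2
    have h3 : Continuous fun p : ℝ × Plane => symb p.2 := h0.comp continuous_snd
    fun_prop
  -- Integrating over `s` yields `1 / (symb ξ + b²)`, which cancels the factor in `𝓕 u` and leaves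
  -- the integrable `‖𝓕 φ‖`.
  have hBi : Integrable (Function.uncurry B) (μ.prod volume) := by
    rw [integrable_prod_iff' hBm]
    constructor
    · refine Eventually.of_forall fun ξ => ?_
      have h : Integrable (fun s => Real.exp (-(b ^ 2 * s)) * Real.exp (-(s * symb ξ))) μ := by
        simp only [hBexp]
        exact exp_neg_integrableOn_Ioi 0 (hPpos ξ)
      exact (h.ofReal (𝕜 := ℂ)).mul_const ((𝓕 u : SchwartzMap Plane ℂ) ξ)
    · refine (𝓕 φ : SchwartzMap Plane ℂ).integrable.norm.congr (Eventually.of_forall fun ξ => ?_)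
      have e1 : ∀ s, ‖Function.uncurry B (s, ξ)‖ = Real.exp (-(symb ξ + b ^ 2) * s) *
          ‖(𝓕 u : SchwartzMap Plane ℂ) ξ‖ := by
        intro s
        simp only [Function.uncurry, B]
        rw [norm_mul, hBexp, Complex.norm_real, Real.norm_of_nonneg (Real.exp_pos _).le]
      simp only [e1]
      rw [integral_mul_const, hBint, hFu, norm_mul, norm_neg, Complex.norm_real,
        Real.norm_of_nonneg (hPpos ξ).le, ← mul_assoc, inv_mul_cancel₀ (hPpos ξ).ne', one_mul]
  -- Fubini, passage to the Fourier side at each fixed time `s`, and Fubini back.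
  calc ∫ x, (greenFn b x : ℂ) * u x
      = ∫ x, ∫ s, A (s, x) ∂μ := by
        refine integral_congr_ae ?_
        filter_upwards [ae_ne_zero_plane] with x hx
        rw [greenFn_eq_integral hb hx, ← integral_complex_ofReal, ← integral_mul_const]
    _ = ∫ s, (∫ x, A (s, x)) ∂μ := (integral_integral_swap (μ := μ) (ν := volume)
        (f := fun (s : ℝ) (x : Plane) => A (s, x)) hAi).symm
    _ = ∫ s, (∫ ξ, B s ξ) ∂μ := by
        refine setIntegral_congr_fun measurableSet_Ioi fun s (hs : 0 < s) => ?_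
        simp only [A, B, Complex.ofReal_mul, mul_assoc]
        rw [integral_const_mul, integral_const_mul, integral_heatKernel_mul hs]
    _ = ∫ ξ, ∫ s, B s ξ ∂μ := integral_integral_swap hBi
    _ = ∫ ξ, -(𝓕 φ : SchwartzMap Plane ℂ) ξ := by
        congr 1; ext ξ
        simp only [B, hBexp]
        rw [integral_mul_const, integral_complex_ofReal, hBint, hFu]
        have : ((symb ξ + b ^ 2 : ℝ) : ℂ) ≠ 0 := by exact_mod_cast (hPpos ξ).ne'
        rw [Complex.ofReal_inv]
        field_simp
    _ = -φ 0 := by rw [integral_neg, schwartz_apply_zero_eq_integral_fourier]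

lemma isWeakSolution_greenFn {b : ℝ} (hb : 0 < b) :
    IsWeakSolution (-(b ^ 2 : ℝ) : ℂ) 1 (fun x => (greenFn b x : ℂ)) := by
  intro φ hφ hc
  have := integral_greenFn_mul hb (hc.toSchwartzMap hφ)
  simp only [SchwartzMap.laplacian_apply] at this
  rw [neg_mul, one_mul]
  exact this

/-! ### Uniqueness of logarithmic expansions -/

/-- Neighbourhoods of the origin have positive measure and points have none. Limits at the origin
are thus determined by the class of a function modulo null sets. -/
lemma neBot_punctured_inf_ae : NeBot (𝓝[≠] (0 : Plane) ⊓ ae volume) := by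
  rw [Filter.inf_neBot_iff_frequently_right]
  intro p hp
  by_contra h
  rw [Filter.not_frequently, eventually_nhdsWithin_iff] at h
  have h1 : {x : Plane | x ∈ ({0}ᶜ : Set Plane) → ¬ p x} ∈ 𝓝 0 := h
  have h2 := Measure.measure_pos_of_mem_nhds (volume : Measure Plane) h1
  refine h2.ne' (measure_mono_null (t := {x | ¬ (p x ∧ x ≠ 0)}) ?_ ?_)
  · intro x hx hx'
    exact hx hx'.2 hx'.1
  · exact hp.and ae_ne_zero_plane

lemma tendsto_log_norm_atBot : Tendsto (fun x : Plane => Real.log ‖x‖) (𝓝[≠] 0) atBot := by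
  refine Real.tendsto_log_nhdsGT_zero.comp (tendsto_nhdsWithin_iff.2 ⟨?_, ?_⟩)
  · have h := (continuous_norm.tendsto (0 : Plane)).mono_left (nhdsWithin_le_nhds (s := {0}ᶜ))
    simpa using h
  · filter_upwards [self_mem_nhdsWithin] with x hx
    exact norm_pos_iff.2 hx

/-- The difference of the expansions makes `(c' - c) log|x|` converge along a nontrivial filter on
which `log|x|` is unbounded. -/
lemma HasLogExpansion.unique {f g : Plane → ℂ} {c d c' d' : ℂ} (hf : HasLogExpansion f c d)
    (hg : HasLogExpansion g c' d') (h : f =ᵐ[volume] g) : c = c' ∧ d = d' := by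
  have := neBot_punctured_inf_ae
  have h1 : Tendsto (fun x : Plane => (c' - c) * (Real.log ‖x‖ : ℂ)) (𝓝[≠] 0 ⊓ ae volume)
      (𝓝 (d - d')) := by
    refine ((hf.sub hg).mono_left inf_le_left).congr' ?_
    filter_upwards [h.filter_mono inf_le_right] with x hx
    rw [hx]; ring
  have h2 : c = c' := by
    by_contra hc
    have hc' : c' - c ≠ 0 := sub_ne_zero.2 (Ne.symm hc)
    have h3 := (h1.const_mul (c' - c)⁻¹).norm
    have h4 : Tendsto (fun x : Plane => |Real.log ‖x‖|) (𝓝[≠] 0 ⊓ ae volume) atTop :=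
      tendsto_abs_atBot_atTop.comp (tendsto_log_norm_atBot.mono_left inf_le_left)
    refine not_tendsto_nhds_of_tendsto_atTop h4 _ (h3.congr fun x => ?_)
    rw [inv_mul_cancel_left₀ hc', Complex.norm_real, Real.norm_eq_abs]
  refine ⟨h2, ?_⟩
  rw [h2] at h1
  simp only [sub_self, zero_mul] at h1
  have := tendsto_nhds_unique h1 tendsto_const_nhds
  exact sub_eq_zero.1 this

lemma HasLogExpansion.sub {f g : Plane → ℂ} {c d c' d' : ℂ} (hf : HasLogExpansion f c d)
    (hg : HasLogExpansion g c' d') : HasLogExpansion (fun x => f x - g x) (c - c') (d - d') := by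
  refine (Filter.Tendsto.sub hf hg).congr fun x => ?_
  ring

lemma HasLogExpansion.const_mul {f : Plane → ℂ} {c d : ℂ} (hf : HasLogExpansion f c d) (k : ℂ) :
    HasLogExpansion (fun x => k * f x) (k * c) (k * d) := by
  refine (Filter.Tendsto.const_mul k hf).congr fun x => ?_
  ring

lemma HasLogExpansion.conj {f : Plane → ℂ} {c d : ℂ} (hf : HasLogExpansion f c d) :
    HasLogExpansion (fun x => conj (f x)) (conj c) (conj d) := by
  refine ((Complex.continuous_conj.tendsto d).comp hf).congr fun x => ?_
  simp

lemma hasLogExpansion_of_continuous {f : Plane → ℂ} (hf : Continuous f) :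
    HasLogExpansion f 0 (f 0) := by
  unfold HasLogExpansion
  simp only [zero_mul, sub_zero]
  exact (hf.tendsto 0).mono_left nhdsWithin_le_nhds

/-! ### Algebra of weak solutions -/

lemma IsWeakSolution.sub {E κ κ' : ℂ} {ψ ψ' : Plane → ℂ} (h : IsWeakSolution E κ ψ)
    (h' : IsWeakSolution E κ' ψ') (hψ : MemLp ψ 2 volume) (hψ' : MemLp ψ' 2 volume) :
    IsWeakSolution E (κ - κ') (fun x => ψ x - ψ' x) := by
  intro φ hφ hc
  simp only [sub_mul]
  rw [integral_sub (integrable_mul_laplacian_add hψ hφ hc E)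
    (integrable_mul_laplacian_add hψ' hφ hc E), h φ hφ hc, h' φ hφ hc]
  ring

lemma IsWeakSolution.const_mul {E κ : ℂ} {ψ : Plane → ℂ} (h : IsWeakSolution E κ ψ) (k : ℂ) :
    IsWeakSolution E (k * κ) (fun x => k * ψ x) := by
  intro φ hφ hc
  simp only [mul_assoc]
  rw [integral_const_mul, h φ hφ hc]
  ring

lemma laplacian_conj {φ : Plane → ℂ} (hφ : ContDiff ℝ ∞ φ) (x : Plane) :
    Δ (fun y => conj (φ y)) x = conj (Δ φ x) := by
  have := laplacian_comp_clm hφ (Complex.conjCLE : ℂ →L[ℝ] ℂ) x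
  simpa using this

lemma contDiff_conj {φ : Plane → ℂ} (hφ : ContDiff ℝ ∞ φ) :
    ContDiff ℝ ∞ (fun y => conj (φ y)) := by
  have := (Complex.conjCLE : ℂ →L[ℝ] ℂ).contDiff.comp hφ
  exact this

lemma IsWeakSolution.conj {E κ : ℂ} {ψ : Plane → ℂ} (h : IsWeakSolution E κ ψ) :
    IsWeakSolution (conj E) (conj κ) (fun x => conj (ψ x)) := by
  intro φ hφ hc
  have h1 := h (fun y => (starRingEnd ℂ) (φ y)) (contDiff_conj hφ)
    (hc.comp_left (g := fun z : ℂ => (starRingEnd ℂ) z) (map_zero _))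
  have h2 := congrArg (starRingEnd ℂ) h1
  rw [← integral_conj] at h2
  simp only [laplacian_conj hφ, map_mul, map_add, map_neg, Complex.conj_conj] at h2
  exact h2

/-! ### The Fourier transform of a weak solution -/

/-- Plancherel. The inverse transform is used because `ψ = 𝓕 Ψ` pairs with `u` as `Ψ` pairs with `𝓕
u`, without a reflection. The middle clause is injectivity. -/
lemma exists_fourierInv {ψ : Plane → ℂ} (hψ : MemLp ψ 2 volume) :
    ∃ Ψ : Plane → ℂ, MemLp Ψ 2 volume ∧ (Ψ =ᵐ[volume] 0 → ψ =ᵐ[volume] 0) ∧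
      ∀ u : SchwartzMap Plane ℂ, ∫ x, ψ x * u x = ∫ ξ, Ψ ξ * (𝓕 u : SchwartzMap Plane ℂ) ξ := by
  set f : L2 := hψ.toLp ψ with hf
  have hfψ : (f : Plane → ℂ) =ᵐ[volume] ψ := hψ.coeFn_toLp
  refine ⟨(𝓕⁻ f : L2), Lp.memLp _, fun h => ?_, fun u => ?_⟩
  · have h1 : (𝓕⁻ f : L2) = 0 := Lp.eq_zero_iff_ae_eq_zero.2 h
    have h2 : f = 0 := by
      have h3 : 𝓕 (𝓕⁻ f : L2) = f := FourierTransform.fourier_fourierInv_eq f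
      have h4 : (𝓕 (0 : L2) : L2) = 0 := map_zero (Lp.fourierTransformₗᵢ Plane ℂ)
      rw [h1] at h3
      rw [← h3]
      exact h4
    exact hfψ.symm.trans (Lp.eq_zero_iff_ae_eq_zero.1 h2)
  · have h1 := congrArg (fun T : TemperedDistribution Plane ℂ => T (𝓕 u))
      (Lp.fourierInv_toTemperedDistribution_eq f)
    simp only [TemperedDistribution.fourierInv_apply, FourierTransform.fourierInv_fourier_eq,
      Lp.toTemperedDistribution_apply, smul_eq_mul] at h1
    rw [← integral_congr_ae (f := fun x => u x * (f : Plane → ℂ) x)]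
    · rw [h1]
      congr 1; ext ξ; ring
    · filter_upwards [hfψ] with x hx
      rw [hx, mul_comm]

/-- The equation `(4π²|ξ|² - E) ψ̌ = κ`. -/
lemma IsWeakSolution.symb_sub_mul_fourierInv {E κ : ℂ} {ψ Ψ : Plane → ℂ}
    (h : IsWeakSolution E κ ψ) (hψ : MemLp ψ 2 volume) (hΨ : MemLp Ψ 2 volume)
    (hu : ∀ u : SchwartzMap Plane ℂ,
      ∫ x, ψ x * u x = ∫ ξ, Ψ ξ * (𝓕 u : SchwartzMap Plane ℂ) ξ) :
    ∀ᵐ ξ, (symb ξ - E) * Ψ ξ = κ := by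
  have hl : LocallyIntegrable Ψ volume := hΨ.locallyIntegrable (by norm_num)
  have hcs : Continuous fun ξ => (symb ξ : ℂ) - E :=
    (Complex.continuous_ofReal.comp continuous_symb).sub continuous_const
  refine ae_eq_of_integral_contDiff_smul_eq (hl.continuous_mul hcs)
    (locallyIntegrable_const κ) fun g hg hc => ?_
  have hgc : ContDiff ℝ ∞ (fun x => ((g x : ℝ) : ℂ)) := Complex.ofRealCLM.contDiff.comp hg
  have hcc : HasCompactSupport (fun x => ((g x : ℝ) : ℂ)) :=
    hc.comp_left (g := fun r : ℝ => (r : ℂ)) Complex.ofReal_zero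
  set G : SchwartzMap Plane ℂ := hcc.toSchwartzMap hgc with hG
  -- The test function whose Fourier transform is the given `g`. It need not have compact support,
  -- hence the earlier extension of the equation to Schwartz functions.
  set φ : SchwartzMap Plane ℂ := 𝓕⁻ G with hφ
  have hφG : (𝓕 φ : SchwartzMap Plane ℂ) = G := FourierTransform.fourier_fourierInv_eq G
  have h1 := h.schwartz hψ φ
  have h2 : ∀ x, (Δ φ) x + E * φ x = (Δ φ + E • φ : SchwartzMap Plane ℂ) x := fun x => by simp
  simp only [h2] at h1
  rw [hu] at h1
  simp only [fourier_laplacian_add] at h1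
  rw [schwartz_apply_zero_eq_integral_fourier, hφG] at h1
  have hGx : ∀ x, G x = (g x : ℂ) := fun x => rfl
  simp only [hGx] at h1
  have e1 : ∫ x, g x • ((symb x - E) * Ψ x) = -∫ ξ, Ψ ξ * ((E - symb ξ) * (g ξ : ℂ)) := by
    rw [← integral_neg]
    congr 1; ext ξ
    rw [Complex.real_smul]; ring
  rw [e1, h1, neg_mul, neg_neg, ← integral_const_mul]
  congr 1; ext ξ
  rw [Complex.real_smul]; ring

/-- The exceptional set is contained in a sphere, which is null. -/
lemma ae_symb_ne (E : ℂ) : ∀ᵐ ξ : Plane, (symb ξ : ℂ) - E ≠ 0 := by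
  have h : {ξ : Plane | ¬ ((symb ξ : ℂ) - E ≠ 0)} ⊆
      Metric.sphere (0 : Plane) (√(E.re) / (2 * Real.pi)) := by
    intro ξ hξ
    have h1 : (symb ξ : ℂ) = E := by simpa [sub_eq_zero] using hξ
    have h2 : symb ξ = E.re := by rw [← h1, Complex.ofReal_re]
    have hpi := Real.pi_pos
    rw [mem_sphere_zero_iff_norm, ← h2, symb, ← mul_pow, Real.sqrt_sq (by positivity)]
    field_simp
  exact measure_mono_null h (Measure.addHaar_sphere _ _ _)

/-- There are no square integrable solutions of `-Δψ = Eψ` on the plane. -/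
lemma IsWeakSolution.eq_zero {E : ℂ} {ψ : Plane → ℂ} (h : IsWeakSolution E 0 ψ)
    (hψ : MemLp ψ 2 volume) : ψ =ᵐ[volume] 0 := by
  obtain ⟨Ψ, hΨ, h0, hu⟩ := exists_fourierInv hψ
  refine h0 ?_
  filter_upwards [h.symb_sub_mul_fourierInv hψ hΨ hu, ae_symb_ne E] with ξ h1 h2
  exact (mul_eq_zero.1 h1).resolve_left h2

/-- For `E ≥ 0` the function `1 / (4π²|ξ|² - E)` is not square integrable on the plane. -/
lemma not_integrable_inv_symb_sub_sq {e : ℝ} (he : 0 ≤ e) :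
    ¬ Integrable (fun ξ : Plane => ((symb ξ - e) ^ 2)⁻¹) := by
  intro h
  have hpi := Real.pi_pos
  set r₀ : ℝ := √e / (2 * Real.pi) with hr₀
  have hr₀0 : 0 ≤ r₀ := by positivity
  have he' : e = (2 * Real.pi) ^ 2 * r₀ ^ 2 := by
    rw [hr₀, div_pow, Real.sq_sqrt he]; field_simp
  have h1 := (integrable_fun_norm_addHaar (volume : Measure Plane)
    (f := fun r => (((2 * Real.pi) ^ 2 * r ^ 2 - e) ^ 2)⁻¹)).1 h
  have hfr : Module.finrank ℝ Plane = 2 := by simp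
  rw [hfr] at h1
  -- In polar coordinates the integrand is a constant times `r / ((r - r₀)² (r + r₀)²)`. On `(r₀, r₀
  -- + 1]` it dominates a multiple of `1 / (r - r₀)`, by `r + r₀ ≤ 2 r₀ + 1` and `r ≥ r - r₀`. This
  -- covers `r₀ = 0` as well.
  have h2 : IntegrableOn (fun r => (r - r₀)⁻¹) (Set.Ioc r₀ (r₀ + 1)) := by
    have h3 := (h1.mono_set (Set.Ioc_subset_Ioi_self.trans (Set.Ioi_subset_Ioi hr₀0) :
      Set.Ioc r₀ (r₀ + 1) ⊆ Set.Ioi 0)).const_mul ((2 * Real.pi) ^ 4 * (2 * r₀ + 1) ^ 2)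
    refine Integrable.mono' h3 (by fun_prop) ((ae_restrict_mem measurableSet_Ioc).mono ?_)
    rintro r ⟨hr1, hr2⟩
    have hd : 0 < r - r₀ := by linarith
    have hs : 0 < r + r₀ := by linarith
    rw [Real.norm_of_nonneg (by positivity), smul_eq_mul, he']
    have e1 : (2 * Real.pi) ^ 4 * (2 * r₀ + 1) ^ 2 *
        (r ^ (2 - 1) * (((2 * Real.pi) ^ 2 * r ^ 2 - (2 * Real.pi) ^ 2 * r₀ ^ 2) ^ 2)⁻¹) =
        (2 * r₀ + 1) ^ 2 * r / ((r - r₀) ^ 2 * (r + r₀) ^ 2) := by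
      have : (2 * Real.pi) ^ 2 * r ^ 2 - (2 * Real.pi) ^ 2 * r₀ ^ 2 =
        (2 * Real.pi) ^ 2 * ((r - r₀) * (r + r₀)) := by ring
      rw [this]
      field_simp
      norm_num
    rw [e1, inv_eq_one_div, div_le_div_iff₀ hd (by positivity)]
    have e2 : (r + r₀) ^ 2 ≤ (2 * r₀ + 1) ^ 2 := pow_le_pow_left₀ hs.le (by linarith) 2
    calc 1 * ((r - r₀) ^ 2 * (r + r₀) ^ 2) = (r + r₀) ^ 2 * (r - r₀) * (r - r₀) := by ring
      _ ≤ (2 * r₀ + 1) ^ 2 * r * (r - r₀) := by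
          refine mul_le_mul_of_nonneg_right ?_ hd.le
          exact mul_le_mul e2 (by linarith) hd.le (by positivity)
  have h4 : IntervalIntegrable (fun r => (r - r₀)⁻¹) volume r₀ (r₀ + 1) :=
    (intervalIntegrable_iff_integrableOn_Ioc_of_le (by linarith)).2 h2
  rw [intervalIntegrable_sub_inv_iff] at h4
  rcases h4 with h4 | h4
  · linarith
  · exact h4 Set.left_mem_uIcc

lemma IsWeakSolution.not_nonneg {e : ℝ} (he : 0 ≤ e) {ψ : Plane → ℂ}
    (h : IsWeakSolution e 1 ψ) (hψ : MemLp ψ 2 volume) : False := by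
  obtain ⟨Ψ, hΨ, -, hu⟩ := exists_fourierInv hψ
  refine not_integrable_inv_symb_sub_sq he ?_
  refine ((memLp_two_iff_integrable_sq_norm hΨ.1).1 hΨ).congr ?_
  filter_upwards [h.symb_sub_mul_fourierInv hψ hΨ hu] with ξ h1
  have h2 := congrArg norm h1
  rw [norm_mul, norm_one, ← Complex.ofReal_sub, Complex.norm_real, Real.norm_eq_abs] at h2
  rw [← sq_abs (symb ξ - e), ← inv_pow, eq_inv_of_mul_eq_one_right h2]

/-- A solution with source `δ` and a real regularized value at the origin has real energy. -/
lemma IsWeakSolution.im_eq_zero {E : ℂ} {ψ : Plane → ℂ} (h : IsWeakSolution E 1 ψ)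
    (hψ : MemLp ψ 2 volume) {c : ℂ} {d : ℝ} (hd : HasLogExpansion ψ c d) : E.im = 0 := by
  by_contra hE
  obtain ⟨Ψ, hΨ, -, hu⟩ := exists_fourierInv hψ
  have hψ' : MemLp (fun x => conj (ψ x)) 2 volume := hψ.star
  obtain ⟨Ψ', hΨ', -, hu'⟩ := exists_fourierInv hψ'
  have h1 := h.symb_sub_mul_fourierInv hψ hΨ hu
  have h2 := h.conj.symb_sub_mul_fourierInv hψ' hΨ' hu'
  rw [map_one] at h2
  -- With `p = symb ξ` real, `1/(p - E) - 1/(p - conj E) = (E - conj E) / |p - E|²`, which is `2i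
  -- (Im E) ‖Ψ‖²`. The difference of two merely square integrable functions is thus integrable.
  let w : Plane → ℂ := fun ξ => (2 * E.im * Complex.I) * ((‖Ψ ξ‖ ^ 2 : ℝ) : ℂ)
  have hw : ∀ᵐ ξ, Ψ ξ - Ψ' ξ = w ξ := by
    filter_upwards [h1, h2] with ξ e1 e2
    have e3 : Ψ' ξ = conj (Ψ ξ) := by
      have e4 := congrArg (starRingEnd ℂ) e1
      simp only [map_mul, map_sub, Complex.conj_ofReal, map_one] at e4
      have hne : (symb ξ : ℂ) - conj E ≠ 0 := fun h0 => by simp [h0] at e4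
      exact mul_left_cancel₀ hne (e2.trans e4.symm)
    have e5 : ((‖Ψ ξ‖ ^ 2 : ℝ) : ℂ) = Ψ ξ * conj (Ψ ξ) := by
      rw [Complex.mul_conj, Complex.normSq_eq_norm_sq]
    have e6 := congrArg (starRingEnd ℂ) e1
    simp only [map_mul, map_sub, Complex.conj_ofReal, map_one] at e6
    have e7 : (2 * E.im * Complex.I : ℂ) = E - conj E := by
      rw [Complex.sub_conj]; push_cast; ring
    simp only [w]
    rw [e5, e7, e3]
    linear_combination (-Ψ ξ) * e6 + (conj (Ψ ξ)) * e1
  have hN : Integrable (fun ξ => ‖Ψ ξ‖ ^ 2) := (memLp_two_iff_integrable_sq_norm hΨ.1).1 hΨ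
  have hwi : Integrable w := (hN.ofReal (𝕜 := ℂ)).const_mul _
  have hcont : Continuous (𝓕 w) :=
    VectorFourier.fourierIntegral_continuous Real.continuous_fourierChar
      (by simpa using continuous_inner) hwi
  have hv : MemLp (fun x => ψ x - conj (ψ x)) 2 volume := hψ.sub hψ'
  have hae : (fun x => ψ x - conj (ψ x)) =ᵐ[volume] 𝓕 w := by
    refine ae_eq_of_integral_contDiff_smul_eq (hv.locallyIntegrable (by norm_num))
      hcont.locallyIntegrable fun g hg hc => ?_
    have hgc : ContDiff ℝ ∞ (fun x => ((g x : ℝ) : ℂ)) := Complex.ofRealCLM.contDiff.comp hg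
    have hcc : HasCompactSupport (fun x => ((g x : ℝ) : ℂ)) :=
      hc.comp_left (g := fun r : ℝ => (r : ℂ)) Complex.ofReal_zero
    let G : SchwartzMap Plane ℂ := hcc.toSchwartzMap hgc
    have hGx : ∀ x, G x = (g x : ℂ) := fun x => rfl
    have e1 : ∀ f : Plane → ℂ, ∫ x, g x • f x = ∫ x, f x * G x := fun f => by
      congr 1; ext x; rw [hGx, Complex.real_smul, mul_comm]
    have hFG : MemLp (𝓕 G : SchwartzMap Plane ℂ) 2 (volume : Measure Plane) :=
      (𝓕 G : SchwartzMap Plane ℂ).memLp 2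
    rw [e1, e1, integral_fourier_mul_schwartz hwi]
    simp only [sub_mul]
    rw [integral_sub (integrable_mul_of_memLp_two hψ (G.memLp 2))
      (integrable_mul_of_memLp_two hψ' (G.memLp 2)), hu G, hu' G,
      ← integral_sub (integrable_mul_of_memLp_two hΨ hFG)
        (integrable_mul_of_memLp_two hΨ' hFG)]
    refine integral_congr_ae ?_
    filter_upwards [hw] with ξ hξ
    rw [← hξ]; ring
  -- Since `d` is real, `ψ - conj ψ` has constant term zero at the origin; by continuity it is also
  -- `𝓕 w 0 = ∫ w`.
  obtain ⟨-, h3⟩ := (hd.sub hd.conj).unique (hasLogExpansion_of_continuous hcont) hae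
  rw [Complex.conj_ofReal, sub_self, Real.fourier_eq] at h3
  simp only [inner_zero_right, neg_zero, AddChar.map_zero_eq_one, one_smul, w] at h3
  rw [integral_const_mul, integral_complex_ofReal] at h3
  have h4 : ∫ ξ, ‖Ψ ξ‖ ^ 2 = 0 := by
    have := (mul_eq_zero.1 h3.symm).resolve_left (by simpa using hE)
    exact_mod_cast this
  rw [integral_eq_zero_iff_of_nonneg (fun ξ => by positivity) hN] at h4
  have h5 : ∀ᵐ ξ : Plane, False := by
    filter_upwards [h4, h1] with ξ e1 e2
    have : Ψ ξ = 0 := by simpa using e1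
    rw [this, mul_zero] at e2
    exact zero_ne_one e2
  exact h5.exists.elim fun _ h => h

/-! ### Determination of the energy -/

/-- The energy `-4 exp (-2γ - 4π / α)` of the bound state. -/
def boundEnergy (α : ℝ) : ℝ :=
  -4 * Real.exp (-2 * Real.eulerMascheroniConstant - 4 * Real.pi / α)

/-- The square root `2 exp (-γ - 2π / α)` of minus the bound energy. -/
def boundRate (α : ℝ) : ℝ :=
  2 * Real.exp (-Real.eulerMascheroniConstant - 2 * Real.pi / α)

lemma boundRate_pos (α : ℝ) : 0 < boundRate α := by unfold boundRate; positivity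

lemma boundRate_sq (α : ℝ) : boundRate α ^ 2 = -boundEnergy α := by
  unfold boundRate boundEnergy
  rw [mul_pow, ← Real.exp_nat_mul, neg_mul, neg_neg]
  norm_num
  ring

/-- The matching condition: a state with source `αd δ = δ` has constant term `d = 1/α`; solving for
`log b` gives the rate. -/
lemma greenFn_value_eq_iff {b α : ℝ} (hb : 0 < b) (hα : α ≠ 0) :
    (Real.log 2 - Real.eulerMascheroniConstant - Real.log b) / (2 * Real.pi) = 1 / α ↔
      b = boundRate α := by
  have hpi := Real.pi_pos
  have h : b = boundRate α ↔ Real.log b =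
      Real.log 2 - Real.eulerMascheroniConstant - 2 * Real.pi / α := by
    rw [← Real.log_injOn_pos.eq_iff hb (boundRate_pos α), boundRate,
      Real.log_mul (by norm_num) (Real.exp_pos _).ne', Real.log_exp]
    constructor <;> intro h <;> linarith
  rw [h, div_eq_div_iff (by positivity) hα, one_mul]
  constructor
  · intro h1
    field_simp
    linarith
  · intro h1
    rw [h1]
    field_simp
    ring

/-- The uniqueness half of both spectral statements: after scaling to a unit source, the energy is
real, then negative, then fixed by comparison with the Green function. -/
lemma energy_eq_boundEnergy {α : ℝ} (hα : α ≠ 0) {E : ℂ} {ψ : Plane → ℂ}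
    (hψ : MemLp ψ 2 volume) (h0 : ¬ ψ =ᵐ[volume] 0) {c d : ℂ} (hl : HasLogExpansion ψ c d)
    (hw : IsWeakSolution E (α * d) ψ) : E = boundEnergy α := by
  have hα' : (α : ℂ) ≠ 0 := by exact_mod_cast hα
  have hκ : (α : ℂ) * d ≠ 0 := by
    intro hκ
    rw [hκ] at hw
    exact h0 (hw.eq_zero hψ)
  have hd : d ≠ 0 := right_ne_zero_of_mul hκ
  set p : Plane → ℂ := fun x => (α * d : ℂ)⁻¹ * ψ x with hp
  have hpL : MemLp p 2 volume := hψ.const_mul _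
  have hpw : IsWeakSolution E 1 p := by
    have := hw.const_mul ((α * d : ℂ)⁻¹)
    rwa [inv_mul_cancel₀ hκ] at this
  have hpl : HasLogExpansion p ((α * d : ℂ)⁻¹ * c) ((1 / α : ℝ) : ℂ) := by
    have h1 := hl.const_mul ((α * d : ℂ)⁻¹)
    have h2 : (α * d : ℂ)⁻¹ * d = ((1 / α : ℝ) : ℂ) := by push_cast; field_simp
    rwa [h2] at h1
  have hE : E = (E.re : ℂ) := Complex.ext rfl (by simpa using hpw.im_eq_zero hpL hpl)
  have hneg : E.re < 0 := by
    by_contra hnn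
    rw [hE] at hpw
    exact IsWeakSolution.not_nonneg (not_lt.1 hnn) hpw hpL
  set b : ℝ := √(-E.re) with hb
  have hbpos : 0 < b := Real.sqrt_pos.2 (by linarith)
  have hEb : E = (-(b ^ 2 : ℝ) : ℂ) := by
    rw [hE, hb, Real.sq_sqrt (by linarith)]; simp
  have hG := isWeakSolution_greenFn hbpos
  rw [← hEb] at hG
  -- The difference with the Green function has no source, so it vanishes almost everywhere.
  have hz := (hpw.sub hG hpL (memLp_greenFn hbpos))
  rw [sub_self] at hz
  have hz0 := hz.eq_zero (hpL.sub (memLp_greenFn hbpos))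
  have heq : p =ᵐ[volume] fun x => (greenFn b x : ℂ) := by
    filter_upwards [hz0] with x hx
    exact sub_eq_zero.1 hx
  have hval := (hpl.unique (hasLogExpansion_greenFn hbpos) heq).2
  have hval' := (greenFn_value_eq_iff hbpos hα).1 (Complex.ofReal_injective hval).symm
  rw [hEb, hval', boundRate_sq]
  simp

/-! ### Removable singularities -/

/-- The integral is the Fourier transform at `ξ = 0`, where the symbol of `Δ` vanishes. -/
lemma integral_laplacian_eq_zero {φ : Plane → ℂ} (hφ : ContDiff ℝ ∞ φ) (hc : HasCompactSupport φ) :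
    ∫ x, Δ φ x = 0 := by
  have h := fourier_laplacian_add (hc.toSchwartzMap hφ) 0 0
  rw [SchwartzMap.fourier_coe, Real.fourier_eq] at h
  have h1 : ∫ x, Δ (hc.toSchwartzMap hφ : Plane → ℂ) x = 0 := by
    simpa [symb, SchwartzMap.laplacian_apply] using h
  exact h1

lemma measureReal_closedBall_plane (r : ℝ) (hr : 0 ≤ r) :
    (volume : Measure Plane).real (Metric.closedBall 0 r) =
      r ^ 2 * (volume : Measure Plane).real (Metric.ball 0 1) := by
  have hfr : Module.finrank ℝ Plane = 2 := by simp
  rw [Measure.real, Measure.addHaar_closedBall _ _ hr, hfr, ENNReal.toReal_mul,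
    ENNReal.toReal_ofReal (by positivity), Measure.real]

/-- A point is removable for the equation `Δu = -f` if `u` has a limit there. -/
lemma integral_laplacian_add_eq_zero_of_punctured {u f : Plane → ℂ} {C : ℂ}
    (hu : MemLp u 2 volume) (hf : MemLp f 2 volume) (hlim : Tendsto u (𝓝[≠] 0) (𝓝 C))
    (h : ∀ φ : Plane → ℂ, ContDiff ℝ ∞ φ → HasCompactSupport φ → tsupport φ ⊆ {0}ᶜ →
      ∫ x, (u x * Δ φ x + f x * φ x) = 0)
    {φ : Plane → ℂ} (hφ : ContDiff ℝ ∞ φ) (hc : HasCompactSupport φ) :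
    ∫ x, (u x * Δ φ x + f x * φ x) = 0 := by
  obtain ⟨χ, B, hχ, hχc, hB, hχ1, hχ2, hχb, hd1, hd2⟩ := exists_cutoff
  let c : ℕ → ℝ := fun n => (n : ℝ) + 1
  have hc1 : ∀ n, 1 ≤ c n := fun n => by simp [c]
  have hc0 : ∀ n, 0 < c n := fun n => one_pos.trans_le (hc1 n)
  have hct : Tendsto c atTop atTop := tendsto_atTop_add_const_right _ _ tendsto_natCast_atTop_atTop
  let Φ : ℕ → Plane → ℂ := fun n y => χ (c n • y) • φ y
  have hΦ : ∀ n, ContDiff ℝ ∞ (Φ n) := fun n => (hχ.comp (contDiff_const_smul (c n))).smul hφ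
  have hΦc : ∀ n, HasCompactSupport (Φ n) := fun n => hc.smul_left (f := fun y => χ (c n • y))
  have hint : ∀ {θ : Plane → ℂ}, ContDiff ℝ ∞ θ → HasCompactSupport θ →
      Integrable (fun x => u x * Δ θ x) ∧ Integrable (fun x => f x * θ x) := fun hθ hθc =>
    ⟨integrable_mul_of_memLp_two hu (memLp_two_of_contDiff (contDiff_laplacian hθ)
      (HasCompactSupport.laplacian hθc)),
      integrable_mul_of_memLp_two hf (memLp_two_of_contDiff hθ hθc)⟩
  -- the part of `φ` away from the origin does not contribute
  have hsplit : ∀ n, ∫ x, (u x * Δ φ x + f x * φ x) =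
      (∫ x, (u x - C) * Δ (Φ n) x) + ∫ x, f x * Φ n x := by
    intro n
    have hθ : ContDiff ℝ ∞ (φ - Φ n) := hφ.sub (hΦ n)
    have hθc : HasCompactSupport (φ - Φ n) := hc.sub (hΦc n)
    have hθ0 : tsupport (φ - Φ n) ⊆ {0}ᶜ := by
      intro x hx
      rintro rfl
      refine notMem_tsupport_iff_eventuallyEq.2 ?_ hx
      have : ∀ᶠ x : Plane in 𝓝 0, ‖c n • x‖ < 1 := by
        have hcc : Continuous fun x : Plane => ‖c n • x‖ := by fun_prop
        exact (hcc.tendsto 0).eventually (gt_mem_nhds (by simp))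
      filter_upwards [this] with x hx
      simp [Φ, hχ1 _ hx.le]
    have h0 := h _ hθ hθc hθ0
    have hΔ : ∀ x, Δ (φ - Φ n) x = Δ φ x - Δ (Φ n) x := fun x =>
      (hφ.contDiffAt.of_le two_le_smooth).laplacian_sub ((hΦ n).contDiffAt.of_le two_le_smooth)
    have i1 := hint hφ hc
    have i2 := hint (hΦ n) (hΦc n)
    have e1 : ∫ x, (u x * Δ (φ - Φ n) x + f x * (φ - Φ n) x) =
        ∫ x, ((u x * Δ φ x + f x * φ x) - (u x * Δ (Φ n) x + f x * Φ n x)) := by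
      congr 1; ext x; rw [hΔ, Pi.sub_apply]; ring
    have i1' : Integrable (fun x => u x * Δ φ x + f x * φ x) := i1.1.add i1.2
    have i2' : Integrable (fun x => u x * Δ (Φ n) x + f x * Φ n x) := i2.1.add i2.2
    rw [e1, integral_sub i1' i2', integral_add i2.1 i2.2] at h0
    have i3 : Integrable (fun x => Δ (Φ n) x) :=
      (contDiff_laplacian (hΦ n)).continuous.integrable_of_hasCompactSupport
        (HasCompactSupport.laplacian (hΦc n))
    -- The limit `C` can be subtracted at no cost because `Δ (Φ n)` has integral zero; this supplies
    -- the smallness near the origin.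
    have e2 : ∫ x, (u x - C) * Δ (Φ n) x = ∫ x, u x * Δ (Φ n) x := by
      simp only [sub_mul]
      rw [integral_sub i2.1 (i3.const_mul C), integral_const_mul,
        integral_laplacian_eq_zero (hΦ n) (hΦc n), mul_zero, sub_zero]
    rw [e2]
    exact sub_eq_zero.1 h0
  -- uniform bounds
  obtain ⟨M0, hM0⟩ := hφ.continuous.bounded_above_of_compact_support hc
  obtain ⟨M1, hM1⟩ := (contDiff_laplacian hφ).continuous.bounded_above_of_compact_support
    (HasCompactSupport.laplacian hc)
  have hb : ∀ i, ∃ K, ∀ x, ‖fderiv ℝ φ x (stdVec i)‖ ≤ K := fun i =>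
    (contDiff_fderiv_apply hφ (stdVec i)).continuous.bounded_above_of_compact_support
      (hc.fderiv_apply ℝ _)
  choose M2 hM2 using hb
  set M : ℝ := B * M0 + 2 * B * ∑ i, M2 i + M1 with hM
  have hgrad : ∀ x, gradSize φ x ≤ ∑ i, M2 i := fun x => Finset.sum_le_sum fun i _ => hM2 i x
  have hgrad0 : ∀ x, 0 ≤ gradSize φ x := fun x => Finset.sum_nonneg fun i _ => norm_nonneg _
  have hM0' : 0 ≤ M0 := (norm_nonneg _).trans (hM0 0)
  have hM1' : 0 ≤ M1 := (norm_nonneg _).trans (hM1 0)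
  have hM2' : 0 ≤ ∑ i, M2 i := (hgrad0 0).trans (hgrad 0)
  have hMpos : 0 ≤ M := by positivity
  have hΔb : ∀ n x, ‖Δ (Φ n) x‖ ≤ M * c n ^ 2 := by
    intro n x
    have h1 := norm_laplacian_smul_scaled_sub_le hχ hφ hd1 hd2 (hc0 n).le x
    have h2 : ‖χ (c n • x) • Δ φ x‖ ≤ M1 * c n ^ 2 := by
      rw [norm_smul, Real.norm_eq_abs]
      have := mul_le_of_le_one_left (norm_nonneg (Δ φ x)) (hχb (c n • x))
      nlinarith [hM1 x, one_le_pow₀ (hc1 n) (n := 2)]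
    have h3 : B * c n ^ 2 * ‖φ x‖ ≤ B * M0 * c n ^ 2 := by
      rw [mul_right_comm]
      have := hM0 x
      gcongr
    have h4 : 2 * B * c n * gradSize φ x ≤ 2 * B * (∑ i, M2 i) * c n ^ 2 := by
      have e1 : c n ≤ c n ^ 2 := by nlinarith [hc1 n]
      calc 2 * B * c n * gradSize φ x ≤ 2 * B * c n ^ 2 * ∑ i, M2 i :=
            mul_le_mul (mul_le_mul_of_nonneg_left e1 (by positivity)) (hgrad x) (hgrad0 x)
              (by positivity)
        _ = _ := by ring
    have h5 := norm_sub_norm_le (Δ (Φ n) x) (χ (c n • x) • Δ φ x)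
    rw [hM]
    nlinarith
  have hΦsupp : ∀ n, tsupport (Φ n) ⊆ Metric.closedBall 0 (2 / c n) := by
    intro n
    refine closure_minimal (fun x hx => ?_) Metric.isClosed_closedBall
    rw [mem_closedBall_zero_iff]
    by_contra hlt
    refine hx ?_
    have : 2 ≤ ‖c n • x‖ := by
      rw [norm_smul, Real.norm_of_nonneg (hc0 n).le]
      have := (div_lt_iff₀ (hc0 n)).1 (not_le.1 hlt)
      linarith
    simp [Φ, hχ2 _ this]
  set V : ℝ := (volume : Measure Plane).real (Metric.ball 0 1) with hV
  have hV0 : 0 ≤ V := measureReal_nonneg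
  have lim1 : Tendsto (fun n => ∫ x, (u x - C) * Δ (Φ n) x) atTop (𝓝 0) := by
    rw [Metric.tendsto_atTop']
    intro ε hε
    -- The bound `M c²` on the Laplacian times the area `4V / c²` leaves `4MVη`; the added `1` keeps
    -- the quotient defined and the inequality strict.
    set η : ℝ := ε / (4 * M * V + 1) with hη
    have hηpos : 0 < η := by positivity
    have hnear : ∀ᶠ x in 𝓝[≠] (0 : Plane), dist (u x) C < η := Metric.tendsto_nhds.1 hlim η hηpos
    rw [eventually_nhdsWithin_iff, Metric.eventually_nhds_iff] at hnear
    obtain ⟨δ, hδ, hnear⟩ := hnear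
    have hev : ∀ᶠ n in atTop, 2 / c n < δ := by
      have : Tendsto (fun n => 2 / c n) atTop (𝓝 0) := hct.const_div_atTop 2
      exact this.eventually (gt_mem_nhds hδ)
    obtain ⟨N, hN⟩ := eventually_atTop.1 hev
    refine ⟨N, fun n hn => ?_⟩
    have hnδ := hN n hn.le
    rw [dist_zero_right]
    have e1 : ∫ x, (u x - C) * Δ (Φ n) x =
        ∫ x in Metric.closedBall (0 : Plane) (2 / c n), (u x - C) * Δ (Φ n) x := by
      refine (setIntegral_eq_integral_of_forall_compl_eq_zero fun x hx => ?_).symm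
      have : x ∉ tsupport (Δ (Φ n)) := fun hx' =>
        hx (hΦsupp n (tsupport_laplacian_subset _ hx'))
      rw [image_eq_zero_of_notMem_tsupport this, mul_zero]
    have e2 : ‖∫ x in Metric.closedBall (0 : Plane) (2 / c n), (u x - C) * Δ (Φ n) x‖ ≤
        (η * (M * c n ^ 2)) * (volume : Measure Plane).real (Metric.closedBall 0 (2 / c n)) := by
      refine norm_setIntegral_le_of_norm_le_const_ae'
        (by exact measure_closedBall_lt_top) ?_
      filter_upwards [ae_ne_zero_plane] with x hx0 hx
      rw [norm_mul, ← dist_eq_norm]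
      have hxd : dist x 0 < δ := lt_of_le_of_lt hx hnδ
      exact mul_le_mul (hnear hxd hx0).le (hΔb n x) (norm_nonneg _) hηpos.le
    rw [e1]
    refine e2.trans_lt ?_
    rw [measureReal_closedBall_plane _ (by have := hc0 n; positivity), ← hV]
    have hcn := hc0 n
    have e3 : η * (M * c n ^ 2) * ((2 / c n) ^ 2 * V) = η * (4 * M * V) := by
      field_simp
      norm_num
      ring
    rw [e3, hη, div_mul_eq_mul_div, div_lt_iff₀ (by positivity)]
    nlinarith
  have lim2 : Tendsto (fun n => ∫ x, f x * Φ n x) atTop (𝓝 0) := by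
    have h1 := tendsto_integral_of_dominated_convergence (μ := (volume : Measure Plane))
      (F := fun n x => f x * Φ n x) (f := fun _ => (0 : ℂ)) (fun x => ‖f x * φ x‖)
      (fun n => (hint (hΦ n) (hΦc n)).2.aestronglyMeasurable) (hint hφ hc).2.norm
      (fun n => Eventually.of_forall fun x => by
        rw [norm_mul, norm_mul, norm_smul, Real.norm_eq_abs]
        exact mul_le_mul_of_nonneg_left (mul_le_of_le_one_left (norm_nonneg _) (hχb _))
          (norm_nonneg _))
      (by
        filter_upwards [ae_ne_zero_plane] with x hx
        refine tendsto_const_nhds.congr' ?_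
        have h2 : Tendsto (fun n => c n * ‖x‖) atTop atTop :=
          hct.atTop_mul_const (norm_pos_iff.2 hx)
        filter_upwards [h2.eventually_ge_atTop 2] with n hn
        have h3 : 2 ≤ ‖c n • x‖ := by rwa [norm_smul, Real.norm_of_nonneg (hc0 n).le]
        simp [Φ, hχ2 _ h3])
    simpa using h1
  have hconst := (lim1.add lim2).congr fun n => (hsplit n).symm
  rw [add_zero] at hconst
  exact tendsto_nhds_unique tendsto_const_nhds hconst

/-- A solution of `-Δψ = Eψ` away from the origin with `ψ(x) = -(q / 2π) log|x| + d + o(1)` solves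
`-Δψ - Eψ = qδ`. -/
lemma isWeakSolution_of_punctured {E q d : ℂ} {ψ : Plane → ℂ} (hψ : MemLp ψ 2 volume)
    (hl : HasLogExpansion ψ (q * ((-1 / (2 * Real.pi) : ℝ) : ℂ)) d)
    (h : ∀ φ : Plane → ℂ, ContDiff ℝ ∞ φ → HasCompactSupport φ → tsupport φ ⊆ {0}ᶜ →
      ∫ x, ψ x * (Δ φ x + E * φ x) = 0) : IsWeakSolution E q ψ := by
  -- Any rate would do; rate `1` is chosen. Since `ΔG = G` off the origin, `u = ψ - qG` solves `Δu =
  -- -(Eψ + qG)` there, and the logarithms cancel.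
  have hG := memLp_greenFn one_pos
  have hGw := isWeakSolution_greenFn one_pos
  have hqG : MemLp (fun x => q * (greenFn 1 x : ℂ)) 2 volume := hG.const_mul q
  have hu : MemLp (fun x => ψ x - q * (greenFn 1 x : ℂ)) 2 volume := hψ.sub hqG
  have hf : MemLp (fun x => E * ψ x + q * (greenFn 1 x : ℂ)) 2 volume := (hψ.const_mul E).add hqG
  have hlim := hl.sub ((hasLogExpansion_greenFn one_pos).const_mul q)
  unfold HasLogExpansion at hlim
  simp only [sub_self, zero_mul, sub_zero] at hlim
  have key : ∀ φ : Plane → ℂ, ContDiff ℝ ∞ φ → HasCompactSupport φ →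
      ∫ x, ((ψ x - q * (greenFn 1 x : ℂ)) * Δ φ x + (E * ψ x + q * (greenFn 1 x : ℂ)) * φ x) =
      (∫ x, ψ x * (Δ φ x + E * φ x)) + q * φ 0 := by
    intro φ hφ hc
    have e1 := hGw φ hφ hc
    have i1 := integrable_mul_laplacian_add hψ hφ hc E
    have i2 := (integrable_mul_laplacian_add hG hφ hc (-(1 ^ 2 : ℝ) : ℂ)).const_mul q
    have e2 : q * φ 0 = -∫ x, q * ((greenFn 1 x : ℂ) * (Δ φ x + (-(1 ^ 2 : ℝ) : ℂ) * φ x)) := by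
      rw [integral_const_mul, e1]; ring
    rw [e2, ← sub_eq_add_neg, ← integral_sub i1 i2]
    congr 1; ext x
    push_cast; ring
  intro φ hφ hc
  have h0 := integral_laplacian_add_eq_zero_of_punctured hu hf hlim (fun θ hθ hθc hθ0 => by
    rw [key θ hθ hθc, h θ hθ hθc hθ0]
    have : θ 0 = 0 := image_eq_zero_of_notMem_tsupport fun h00 => hθ0 h00 rfl
    rw [this, mul_zero, add_zero]) hφ hc
  rw [key φ hφ hc] at h0
  linear_combination h0

/-! ### The adjoint of the minimal operator -/

lemma negLaplacianTest_apply (f : PuncturedTest) (x : Plane) :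
    negLaplacianTest f x = -Δ (f : Plane → ℂ) x := by
  rw [← testLaplacian_apply f x]
  rfl

/-- A smooth function with compact support away from the origin as a test function. -/
def puncturedTest (φ : Plane → ℂ) (hφ : ContDiff ℝ ∞ φ) (hc : HasCompactSupport φ)
    (h0 : tsupport φ ⊆ {0}ᶜ) : PuncturedTest :=
  ⟨φ, hφ, hc, h0⟩

lemma inner_testToL2 (ψ : L2) (f : PuncturedTest) :
    inner ℂ ψ (testToL2 f) = ∫ x, f x * conj ((ψ : Plane → ℂ) x) := by
  rw [MeasureTheory.L2.inner_def]
  refine integral_congr_ae ?_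
  filter_upwards [(memLp_test f).coeFn_toLp] with x hx
  have : (testToL2 f : Plane → ℂ) x = f x := hx
  rw [this]
  simp

/-- Density makes the adjoint meaningful. A function orthogonal to the domain vanishes almost
everywhere off the origin, and the origin is null. -/
lemma dense_minimalOperator_domain : Dense (minimalOperator.domain : Set L2) := by
  rw [Submodule.dense_iff_topologicalClosure_eq_top, Submodule.topologicalClosure_eq_top_iff,
    Submodule.eq_bot_iff]
  intro ψ hψ
  have hL : LocallyIntegrable (fun x => conj ((ψ : Plane → ℂ) x)) volume :=
    (Lp.memLp ψ).star.locallyIntegrable (by norm_num)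
  have h := (isOpen_compl_singleton (x := (0 : Plane))).ae_eq_zero_of_integral_contDiff_smul_eq_zero
    (hL.locallyIntegrableOn _) fun g hg hc h0 => by
      have hgc : ContDiff ℝ ∞ (fun x => ((g x : ℝ) : ℂ)) := Complex.ofRealCLM.contDiff.comp hg
      have hcc : HasCompactSupport (fun x => ((g x : ℝ) : ℂ)) :=
        hc.comp_left (g := fun r : ℝ => (r : ℂ)) Complex.ofReal_zero
      have h00 : tsupport (fun x => ((g x : ℝ) : ℂ)) ⊆ {0}ᶜ :=
        (tsupport_comp_subset (g := fun r : ℝ => (r : ℂ)) Complex.ofReal_zero g).trans h0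
      have h1 := inner_testToL2 ψ (puncturedTest _ hgc hcc h00)
      have h2 : inner ℂ ψ (testToL2 (puncturedTest _ hgc hcc h00)) = 0 :=
        Submodule.inner_left_of_mem_orthogonal (LinearMap.mem_range_self testToL2 _) hψ
      rw [h2] at h1
      rw [h1]
      congr 1
  refine Lp.eq_zero_iff_ae_eq_zero.2 ?_
  filter_upwards [h, ae_ne_zero_plane] with x h1 h2
  simpa using h1 h2

/-- The inner product conjugates `ψ`; conjugating the identity moves the bar onto the test function,
and the test space is closed under conjugation. -/
lemma smul_eq_adjoint_iff (ψ : L2) (E : ℂ) :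
    (∀ x : minimalOperator.domain, inner ℂ (E • ψ) (x : L2) = inner ℂ ψ (minimalOperator x)) ↔
      ∀ φ : Plane → ℂ, ContDiff ℝ ∞ φ → HasCompactSupport φ → tsupport φ ⊆ {0}ᶜ →
        ∫ x, (ψ : Plane → ℂ) x * (Δ φ x + E * φ x) = 0 := by
  have hψ : MemLp (ψ : Plane → ℂ) 2 volume := Lp.memLp ψ
  have key : ∀ f : PuncturedTest,
      (inner ℂ (E • ψ) (testToL2 f) = inner ℂ ψ (testToL2 (negLaplacianTest f)) ↔
        ∫ x, (ψ : Plane → ℂ) x * (Δ (fun y => conj (f y)) x + E * conj (f x)) = 0) := by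
    intro f
    have hf : ContDiff ℝ ∞ f := f.contDiff
    have hfc : HasCompactSupport f := f.hasCompactSupport
    have hfL : MemLp f 2 (volume : Measure Plane) := memLp_two_of_contDiff hf hfc
    have hΔL : MemLp (Δ (f : Plane → ℂ)) 2 (volume : Measure Plane) :=
      memLp_two_of_contDiff (contDiff_laplacian hf) (HasCompactSupport.laplacian hfc)
    have i1 : Integrable (fun x => (ψ : Plane → ℂ) x * conj (f x)) :=
      integrable_mul_of_memLp_two hψ hfL.star
    have i2 : Integrable (fun x => (ψ : Plane → ℂ) x * conj (Δ (f : Plane → ℂ) x)) :=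
      integrable_mul_of_memLp_two hψ hΔL.star
    have e1 : conj (inner ℂ (E • ψ) (testToL2 f)) = E * ∫ x, (ψ : Plane → ℂ) x * conj (f x) := by
      rw [inner_smul_left, inner_testToL2, map_mul, Complex.conj_conj, ← integral_conj]
      congr 2; ext x; simp [mul_comm]
    have e2 : conj (inner ℂ ψ (testToL2 (negLaplacianTest f))) =
        -∫ x, (ψ : Plane → ℂ) x * conj (Δ (f : Plane → ℂ) x) := by
      rw [inner_testToL2, ← integral_conj, ← integral_neg]
      congr 1; ext x
      rw [negLaplacianTest_apply]
      simp [mul_comm]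
    have e3 : ∫ x, (ψ : Plane → ℂ) x * (Δ (fun y => conj (f y)) x + E * conj (f x)) =
        (∫ x, (ψ : Plane → ℂ) x * conj (Δ (f : Plane → ℂ) x)) +
          E * ∫ x, (ψ : Plane → ℂ) x * conj (f x) := by
      rw [← integral_const_mul, ← integral_add i2 (i1.const_mul E)]
      congr 1; ext x
      rw [laplacian_conj hf]
      ring
    rw [e3, ← (starRingEnd ℂ).injective.eq_iff, e1, e2]
    constructor <;> intro hh
    · rw [hh]; ring
    · linear_combination hh
  constructor
  · intro h φ hφ hc h0
    have hφ' := contDiff_conj hφ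
    have hc' : HasCompactSupport (fun y => conj (φ y)) :=
      hc.comp_left (g := fun z : ℂ => (starRingEnd ℂ) z) (map_zero _)
    have h0' : tsupport (fun y => conj (φ y)) ⊆ {0}ᶜ :=
      (tsupport_comp_subset (g := fun z : ℂ => (starRingEnd ℂ) z) (map_zero _) φ).trans h0
    have h1 := h ⟨testToL2 (puncturedTest _ hφ' hc' h0'), LinearMap.mem_range_self _ _⟩
    rw [minimalOperator_apply] at h1
    have h2 := (key _).1 h1
    have h3 : ∀ y, conj (puncturedTest _ hφ' hc' h0' y) = φ y := fun y => Complex.conj_conj _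
    simpa only [h3] using h2
  · rintro h ⟨_, f, rfl⟩
    rw [minimalOperator_apply]
    refine (key f).2 (h _ (contDiff_conj f.contDiff) ?_ ?_)
    · exact f.hasCompactSupport.comp_left (g := fun z : ℂ => (starRingEnd ℂ) z) (map_zero _)
    · exact (tsupport_comp_subset (g := fun z : ℂ => (starRingEnd ℂ) z) (map_zero _) f).trans
        f.tsupport_subset

/-- The eigenvalue equation for the point-interaction Hamiltonian, in weak form. -/
lemma mem_pointSpectrum_iff (a : ℝ) (E : ℂ) :
    E ∈ pointSpectrum (pointHamiltonian a) ↔ ∃ ψ : L2, ψ ≠ 0 ∧ ψ ∈ boundaryCondition a ∧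
      ∀ φ : Plane → ℂ, ContDiff ℝ ∞ φ → HasCompactSupport φ → tsupport φ ⊆ {0}ᶜ →
        ∫ x, (ψ : Plane → ℂ) x * (Δ φ x + E * φ x) = 0 := by
  constructor
  · rintro ⟨⟨ψ, hb, hd⟩, h0, h⟩
    refine ⟨ψ, fun h' => h0 (Subtype.ext h'), hb, (smul_eq_adjoint_iff ψ E).1 fun x => ?_⟩
    have h1 : minimalOperator.adjoint ⟨ψ, hd⟩ = E • ψ := h
    rw [← h1]
    exact LinearPMap.adjoint_isFormalAdjoint dense_minimalOperator_domain ⟨ψ, hd⟩ x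
  · rintro ⟨ψ, h0, hb, h⟩
    have h1 := (smul_eq_adjoint_iff ψ E).2 h
    -- No regularity has to be proved: the weak equation itself exhibits `E • ψ` as the value of the
    -- adjoint.
    have hd : ψ ∈ minimalOperator.adjoint.domain :=
      LinearPMap.mem_adjoint_domain_of_exists ψ ⟨E • ψ, h1⟩
    refine ⟨⟨ψ, hb, hd⟩, fun h' => h0 (congrArg Subtype.val h'), ?_⟩
    exact LinearPMap.adjoint_apply_eq dense_minimalOperator_domain ⟨ψ, hd⟩ h1

/-! ### The bound state -/

lemma greenFn_not_ae_zero {b : ℝ} (hb : 0 < b) :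
    ¬ (fun x => (greenFn b x : ℂ)) =ᵐ[volume] (0 : Plane → ℂ) := by
  intro h
  have h1 : ∀ᵐ x : Plane, False := by
    filter_upwards [h, ae_ne_zero_plane] with x hx h0
    have : greenFn b x = 0 := by simpa using hx
    exact (greenFn_pos hb h0).ne' this
  exact h1.exists.elim fun _ h => h

lemma hasLogExpansion_greenFn_boundRate {α : ℝ} (hα : α ≠ 0) :
    HasLogExpansion (fun x => (greenFn (boundRate α) x : ℂ)) ((-1 / (2 * Real.pi) : ℝ) : ℂ)
      ((1 / α : ℝ) : ℂ) := by
  have h := hasLogExpansion_greenFn (boundRate_pos α)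
  rwa [(greenFn_value_eq_iff (boundRate_pos α) hα).2 rfl] at h

lemma isWeakSolution_greenFn_boundRate (α : ℝ) :
    IsWeakSolution (boundEnergy α) 1 (fun x => (greenFn (boundRate α) x : ℂ)) := by
  have h := isWeakSolution_greenFn (boundRate_pos α)
  rwa [boundRate_sq, Complex.ofReal_neg, neg_neg] at h

/-- Every nonzero multiple of the Green function is a stationary state. -/
lemma isStationaryState_const_mul_greenFn {ħ m α L : ℝ} (h : ħ ^ 2 / m = 2) (hL : |L| = 1)
    (hα : α ≠ 0) {k : ℂ} (hk : k ≠ 0) :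
    IsStationaryState ħ m α L (boundEnergy α)
      (fun x => k * (greenFn (boundRate α) x : ℂ)) := by
  refine (isStationaryState_iff h hL _ _).2 ⟨(memLp_greenFn (boundRate_pos α)).const_mul k,
    fun h0 => greenFn_not_ae_zero (boundRate_pos α) ?_, _, _,
    (hasLogExpansion_greenFn_boundRate hα).const_mul k, ?_⟩
  · filter_upwards [h0] with x hx
    exact (mul_eq_zero.1 hx).resolve_left hk
  · have h1 := (isWeakSolution_greenFn_boundRate α).const_mul k
    have h2 : (α : ℂ) * (k * ((1 / α : ℝ) : ℂ)) = k * 1 := by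
      have : (α : ℂ) ≠ 0 := by exact_mod_cast hα
      push_cast
      field_simp
    rwa [h2]

lemma cSpectrum_eq {ħ m α L : ℝ} (h : ħ ^ 2 / m = 2) (hL : |L| = 1) (hα : α ≠ 0) :
    cSpectrum ħ m α L = {(boundEnergy α : ℂ)} := by
  ext E
  simp only [cSpectrum, Set.mem_ofPred_eq, Set.mem_singleton_iff]
  constructor
  · rintro ⟨ψ, hψ⟩
    obtain ⟨hL2, h0, c, d, hl, hw⟩ := (isStationaryState_iff h hL E ψ).1 hψ
    exact energy_eq_boundEnergy hα hL2 h0 hl hw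
  · rintro rfl
    exact ⟨_, isStationaryState_const_mul_greenFn h hL hα one_ne_zero⟩

lemma boundWave_eq {ħ m : ℝ} (hħ : 0 < ħ) (h : ħ ^ 2 / m = 2) (α : ℝ) :
    boundWave ħ m (boundEnergy α) = fun x =>
      ((boundRate α / √Real.pi * (2 * Real.pi) : ℝ) : ℂ) * (greenFn (boundRate α) x : ℂ) := by
  have hm : m ≠ 0 := by
    rintro rfl
    simp at h
  have h1 : 2 * m / ħ ^ 2 = 1 := by
    rw [div_eq_iff hm] at h
    rw [h, div_self (by positivity)]
  have h2 : √(2 * m * |boundEnergy α| / ħ ^ 2) = boundRate α := by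
    have h3 : boundEnergy α = -(boundRate α ^ 2) := by rw [boundRate_sq, neg_neg]
    rw [mul_div_right_comm, h1, one_mul, h3, abs_neg, abs_of_nonneg (by positivity),
      Real.sqrt_sq (boundRate_pos α).le]
  ext x
  have hpi := Real.pi_pos
  simp only [boundWave, h2, greenFn]
  rw [← Complex.ofReal_mul]
  congr 1
  field_simp

lemma pointSpectrum_eq {a : ℝ} (ha : a ≠ 0) :
    pointSpectrum (pointHamiltonian a) = {(boundEnergy (1 / a) : ℂ)} := by
  have hα : 1 / a ≠ 0 := one_div_ne_zero ha
  have hpi : (Real.pi : ℂ) ≠ 0 := by exact_mod_cast Real.pi_ne_zero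
  ext E
  rw [mem_pointSpectrum_iff, Set.mem_singleton_iff]
  constructor
  · rintro ⟨ψ, h0, ⟨q, f, hf, ht⟩, hw⟩
    have hfL : MemLp f 2 volume := (memLp_congr_ae hf).1 (Lp.memLp ψ)
    have hl : HasLogExpansion f (q * ((-1 / (2 * Real.pi) : ℝ) : ℂ)) (a * q) := by
      refine ht.congr fun x => ?_
      push_cast
      ring
    have hwf := isWeakSolution_of_punctured (E := E) hfL hl fun φ hφ hc hφ0 => by
      rw [← hw φ hφ hc hφ0]
      refine integral_congr_ae ?_
      filter_upwards [hf] with x hx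
      rw [hx]
    -- The source `q` is `1/a` times the constant term `aq`, so the coupling is `α = 1/a`.
    have hq : q = ((1 / a : ℝ) : ℂ) * (a * q) := by
      have : (a : ℂ) ≠ 0 := by exact_mod_cast ha
      push_cast
      field_simp
    rw [hq] at hwf
    refine energy_eq_boundEnergy hα hfL (fun hf0 => h0 ?_) hl hwf
    exact Lp.eq_zero_iff_ae_eq_zero.2 (hf.trans hf0)
  · rintro rfl
    have hL := memLp_greenFn (boundRate_pos (1 / a))
    -- The Green function has source `δ`, so `q = 1`; its constant term `1/(1/a) = a` is then the
    -- required one.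
    refine ⟨hL.toLp _, fun h0 => ?_, ⟨1, _, hL.coeFn_toLp, ?_⟩, fun φ hφ hc hφ0 => ?_⟩
    · refine greenFn_not_ae_zero (boundRate_pos (1 / a)) ?_
      exact hL.coeFn_toLp.symm.trans (Lp.eq_zero_iff_ae_eq_zero.1 h0)
    · have h1 := hasLogExpansion_greenFn_boundRate hα
      rw [one_div_one_div] at h1
      rw [mul_one]
      refine Tendsto.congr (fun x => ?_) h1
      push_cast
      ring
    · have h1 := isWeakSolution_greenFn_boundRate (1 / a) φ hφ hc
      have h2 : φ 0 = 0 := image_eq_zero_of_notMem_tsupport fun h00 => hφ0 h00 rfl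
      rw [h2, mul_zero] at h1
      rw [← h1]
      refine integral_congr_ae ?_
      filter_upwards [hL.coeFn_toLp] with x hx
      rw [hx]

end PointInteraction

end

theorem mainTheorem4 (ħ m : ℝ) (hħ : 0 < ħ) (hm : 0 < m) (hħm : ħ ^ 2 / m = 2)
    (L : ℝ) (hL : L = 1 ∨ L = -1) :
    (∀ α : ℝ, α ≠ 0 →
      PointInteraction.cSpectrum ħ m α L =
        {((-4 * Real.exp (-2 * Real.eulerMascheroniConstant - 4 * Real.pi / α) : ℝ) : ℂ)} ∧
      ∀ E : ℝ, (E : ℂ) ∈ PointInteraction.cSpectrum ħ m α L →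
        PointInteraction.IsStationaryState ħ m α L E (PointInteraction.boundWave ħ m E)) ∧
    (∀ a : ℝ, a ≠ 0 →
      PointInteraction.pointSpectrum (PointInteraction.pointHamiltonian a) =
        PointInteraction.cSpectrum ħ m (1 / a) L) := by
  have hL1 : |L| = 1 := by rcases hL with rfl | rfl <;> simp
  refine ⟨fun α hα => ⟨PointInteraction.cSpectrum_eq hħm hL1 hα, fun E hE => ?_⟩, fun a ha => ?_⟩
  · rw [PointInteraction.cSpectrum_eq hħm hL1 hα, Set.mem_singleton_iff] at hE
    have hE' : E = PointInteraction.boundEnergy α := Complex.ofReal_injective hE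
    rw [hE', PointInteraction.boundWave_eq hħ hħm]
    refine PointInteraction.isStationaryState_const_mul_greenFn hħm hL1 hα ?_
    have hb := PointInteraction.boundRate_pos α
    have hpi := Real.pi_pos
    exact Complex.ofReal_ne_zero.2 (by positivity)
  · rw [PointInteraction.pointSpectrum_eq ha,
      PointInteraction.cSpectrum_eq hħm hL1 (one_div_ne_zero ha)]
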